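/- \textbf{Definitions.} Let $\kappa$ be a cardinal and $\theta$ an ordinal. A \emph{$\theta$-strongness embedding} (with critical point $\kappa$) is an elementary embedding $j\colon V\to M$ into a transitive class $M$ with critical point $\kappa$ and $V_\theta\subseteq M$; the cardinal $\kappa$ is \emph{$\theta$-strong} if there is one. A \emph{$\theta$-strongness Laver function} for $\kappa$ is a function $\ell\colon\kappa\to V_\kappa$ such that for every $a\in V_\theta$ there is a $\theta$-strongness embedding $j$ with critical point $\kappa$ and $j(\ell)(\kappa)=a$. A \emph{$\theta$-strongness joint Laver sequence of length $\lambda$} for $\kappa$ is a sequence $\langle \ell_\alpha;\alpha<\lambda\rangle$ of $\theta$-strongness Laver functions for $\kappa$ such that for every sequence $\langle a_\alpha;\alpha<\lambda\rangle$ of elements of $V_\theta$ there is a single $\theta$-strongness embedding $j$ with critical point $\kappa$ such that $j(\ell_\alpha)(\kappa)=a_\alpha$ for all $\alpha<\lambda$. A \emph{$(\kappa,V_\theta)$-extender} is a set $E=\{(a,X) : a\in V_\theta,\ X\subseteq V_\kappa,\ a\in j(X)\}$, where $j$ is a $\theta$-strongness embedding with critical point $\kappa$ and $\theta<j(\kappa)$.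 The ultrapower of $V$ by $E$ consists of the classes $[a,h]$ with $a\in V_\theta$ and $h\colon V_\kappa\to V$, where (for limit $\theta$) $[a,h]\in[b,g]$ means $((a,b),\{(x,y)\in V_\kappa : h(x)\in g(y)\})\in E$, and likewise for $=$. The \emph{$\theta$-strongness Mitchell order} $\triangleleft$ for $\kappa$ is defined on the set of $(\kappa,V_\theta)$-extenders by: $E\triangleleft F$ if $E$ is an element of the transitive collapse of the ultrapower of $V$ by $F$. The \emph{$\theta$-strongness Mitchell rank} of $\kappa$ is the height $\sup\{\operatorname{rank}_{\triangleleft}(E)+1\}$ of this order; its largest possible value is $\beth_\theta^+$. \textbf{Theorem.} Let $\kappa$ be a $\theta$-strong cardinal, where $\theta$ is a limit ordinal and $\operatorname{cf}(\theta)\leq\kappa<\theta$. If there is a $\theta$-strongness joint Laver sequence for $\kappa$ of length $\operatorname{cf}(\theta)$, then $\kappa$ has maximal $\theta$-strongness Mitchell rank; that is, the $\theta$-strongness Mitchell order for $\kappa$ is well-founded and its height is exactly $\beth_\theta^+$. -/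

import Mathlib

open scoped ZFSet

universe u

namespace StrongLaver

/-- The relation symbols of the first-order language of set theory: one binary symbol. -/
inductive MemRel : ℕ → Type
  | mem : MemRel 2

/-- The first-order language of set theory. -/
def setLanguage : FirstOrder.Language := ⟨fun _ => Empty, MemRel⟩

/-- The universe `V`, that is `(ZFSet, ∈)`. -/
instance structureV : setLanguage.Structure ZFSet.{u} where
  funMap f _ := nomatch f
  RelMap | .mem => fun x => x 0 ∈ x 1

/-- A class `M` of sets, as the structure `(M, ∈)`. -/
instance structureClass (M : Set ZFSet.{u}) : setLanguage.Structure M where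
  funMap f _ := nomatch f
  RelMap | .mem => fun x => (x 0 : ZFSet.{u}) ∈ (x 1 : ZFSet.{u})

/-- `M` is a transitive class. -/
def IsTransitiveClass (M : Set ZFSet.{u}) : Prop :=
  ∀ x ∈ M, ∀ y ∈ x, y ∈ M

/-- A `θ`-strongness embedding with critical point `κ`: an elementary embedding `j : V → M`
into a transitive class `M` with critical point `κ` and `V_θ ⊆ M`. -/
structure StrongnessEmbedding (κ : Cardinal.{u}) (θ : Ordinal.{u}) where
  /-- the target model -/
  M : Set ZFSet.{u}
  /-- the embedding, elementary for all first-order formulas of set theory -/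
  j : FirstOrder.Language.ElementaryEmbedding setLanguage ZFSet.{u} M
  transitive : IsTransitiveClass M
  fix_below : ∀ α < κ.ord, (j α.toZFSet : ZFSet.{u}) = α.toZFSet
  move_crit : (j κ.ord.toZFSet : ZFSet.{u}) ≠ κ.ord.toZFSet
  strong : ∀ x ∈ V_ θ, x ∈ M

/-- `κ` is `θ`-strong. -/
def IsStrong (κ : Cardinal.{u}) (θ : Ordinal.{u}) : Prop :=
  Nonempty (StrongnessEmbedding κ θ)

/-- The function `ℓ` with domain `κ` guesses `a` via `j`, that is `j(ℓ)(κ) = a`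
(functions are sets of ordered pairs). -/
def Guesses {κ : Cardinal.{u}} {θ : Ordinal.{u}} (e : StrongnessEmbedding κ θ)
    (ℓ a : ZFSet.{u}) : Prop :=
  ZFSet.pair κ.ord.toZFSet a ∈ (e.j ℓ : ZFSet.{u})

/-- `ℓ : κ → V_κ` is a `θ`-strongness Laver function for `κ`. -/
def IsLaverFunction (κ : Cardinal.{u}) (θ : Ordinal.{u}) (ℓ : ZFSet.{u}) : Prop :=
  ZFSet.IsFunc κ.ord.toZFSet (V_ κ.ord) ℓ ∧
    ∀ a ∈ V_ θ, ∃ e : StrongnessEmbedding κ θ, Guesses e ℓ a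

/-- `⟨ℓ α; α < lam⟩` is a `θ`-strongness joint Laver sequence for `κ` (only the values
of `ℓ` and `a` below `lam` matter). -/
def IsJointLaverSequence (κ : Cardinal.{u}) (θ lam : Ordinal.{u})
    (ℓ : Ordinal.{u} → ZFSet.{u}) : Prop :=
  (∀ α < lam, IsLaverFunction κ θ (ℓ α)) ∧
    ∀ a : Ordinal.{u} → ZFSet.{u}, (∀ α < lam, a α ∈ V_ θ) →
      ∃ e : StrongnessEmbedding κ θ, ∀ α < lam, Guesses e (ℓ α) (a α)

/-- The family of measures on `V_κ` indexed by `V_θ` derived from `j`, coded as the set of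
pairs `(a, X)` with `a ∈ V_θ`, `X ⊆ V_κ` and `a ∈ j(X)`. -/
noncomputable def derivedExtender {κ : Cardinal.{u}} {θ : Ordinal.{u}}
    (e : StrongnessEmbedding κ θ) : ZFSet.{u} :=
  ((V_ θ).prod (V_ κ.ord).powerset).sep
    fun p => ∃ a X : ZFSet.{u}, p = ZFSet.pair a X ∧ a ∈ (e.j X : ZFSet.{u})

/-- `E` is a `(κ, V_θ)`-extender: it is derived from a `θ`-strongness embedding `j` with
critical point `κ` and `θ < j(κ)`. -/
def IsExtender (κ : Cardinal.{u}) (θ : Ordinal.{u}) (E : ZFSet.{u}) : Prop :=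
  ∃ e : StrongnessEmbedding κ θ,
    θ.toZFSet ∈ (e.j κ.ord.toZFSet : ZFSet.{u}) ∧ E = derivedExtender e

/-- Representatives `(a, h)`, with `a ∈ V_θ` and `h : V_κ → V`, of the elements `[a, h]` of the
ultrapower of `V` by a `(κ, V_θ)`-extender. -/
abbrev UltRep (κ : Cardinal.{u}) (θ : Ordinal.{u}) : Type (u + 1) :=
  {a : ZFSet.{u} // a ∈ V_ θ} × ({x : ZFSet.{u} // x ∈ V_ κ.ord} → ZFSet.{u})

/-- `[a, h] R [b, g]` in the ultrapower by `E`: the set of all `(x, y) ∈ V_κ` with `h(x) R g(y)`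
belongs to the measure of `E` with index `(a, b)`. -/
def UltRel {κ : Cardinal.{u}} {θ : Ordinal.{u}} (E : ZFSet.{u})
    (R : ZFSet.{u} → ZFSet.{u} → Prop) (p q : UltRep κ θ) : Prop :=
  ZFSet.pair (ZFSet.pair p.1.1 q.1.1)
    ((V_ κ.ord).sep fun z => ∃ x y : {x : ZFSet.{u} // x ∈ V_ κ.ord},
      z = ZFSet.pair x.1 y.1 ∧ R (p.2 x) (q.2 y)) ∈ E

/-- `π` induces an isomorphism of the ultrapower of `V` by `E` with the transitive class `N`,
that is `N` is the transitive collapse of that ultrapower. -/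
structure IsUltrapowerCollapse {κ : Cardinal.{u}} {θ : Ordinal.{u}} (E : ZFSet.{u})
    (N : Set ZFSet.{u}) (π : UltRep κ θ → ZFSet.{u}) : Prop where
  transitive : IsTransitiveClass N
  range_eq : Set.range π = N
  eq_iff : ∀ p q, π p = π q ↔ UltRel E (· = ·) p q
  mem_iff : ∀ p q, π p ∈ π q ↔ UltRel E (· ∈ ·) p q

/-- The `θ`-strongness Mitchell order for `κ` on the set of `(κ, V_θ)`-extenders: `E ◁ F` if `E`
is an element of the transitive collapse of the ultrapower of `V` by `F`. -/
def MitchellOrder (κ : Cardinal.{u}) (θ : Ordinal.{u})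
    (E F : {E : ZFSet.{u} // IsExtender κ θ E}) : Prop :=
  ∃ (N : Set ZFSet.{u}) (π : UltRep κ θ → ZFSet.{u}),
    IsUltrapowerCollapse F.1 N π ∧ E.1 ∈ N

/-- The `θ`-strongness Mitchell rank of `κ` is `o`: the Mitchell order is well-founded and its
height, the supremum of all `rank(E) + 1`, is `o`. (The set of extenders is a type in the
universe `u + 1`, so its height is compared with the lift of `o`.) -/
def HasMitchellRank (κ : Cardinal.{u}) (θ o : Ordinal.{u}) : Prop :=
  ∃ _ : IsWellFounded _ (MitchellOrder κ θ),
    ⨆ E, Order.succ (IsWellFounded.rank (MitchellOrder κ θ) E) = Ordinal.lift.{u + 1} o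

end StrongLaver

/-! Write [a, f] for the elements of an ultrapower by an extender derived from j; they correspond to
the values j(f)(a). Since θ < j(κ), V_θ is contained in j(V_κ), so these values make sense for all a
in V_θ; Łoś's theorem then gives an elementary embedding into the transitive collapse N, and the
collapse is the identity on V_θ.

Well-foundedness. Let `Prec` be the disjoint union of all well-founded relations on V_κ. Each
extender E induces on representatives the well-founded relation "[a, f] is `Prec`-below [b, g]",
whose height is `extenderRank`. Only functions from V_κ to the field of `Prec` matter, and these lie
in V_θ. Hence if E belongs to the ultrapower N by F, then N contains this relation of E, extended by
a new top, as a well-founded relation R on j(V_κ). So R is one of the relations joined in the `Prec`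
of N, and x ↦ (R, x) shows that the height for F is strictly larger (`exists_embedding_of_mem`,
`extenderRank_lt`).

Upper bound. If E = [a, f] in the ultrapower by F, then E is determined by F, a and the set of (x,
y) with x ∈ f(y) (`exists_code_of_mitchellOrder`). So F has at most |V_θ| = ℶ_θ predecessors, and
all ranks are below the regular cardinal ℶ_θ^+.

Lower bound. A subset C of V_θ is cut along a cofinal sequence into cf(θ) pieces, each an element of
V_θ. One embedding j guesses all pieces at κ. As cf(θ) ≤ κ, the Laver functions form a single set L
⊆ V_κ whose indices are fixed by j, and the pieces are read off from j(L). If C has elements of rank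
unbounded in θ, this forces θ < j(κ), and the ultrapower by the derived extender contains every
section of C (`exists_extender_of_joint`). Letting C code ℶ_θ extenders as its sections gives a
common upper bound (`exists_upper_bound`). Induction then yields extenders of rank at least ξ for
every ξ < ℶ_θ^+ (`exists_le_rank`). -/

namespace StrongLaver

/-! ### Absoluteness of bounded formulas between transitive classes -/

open FirstOrder FirstOrder.Language

/-- The membership symbol. -/
def memSymbol : setLanguage.Relations 2 := MemRel.mem

/-- A structure for the language of set theory that `c` identifies with a transitive class. -/
structure IsTransitiveModel {S : Type (u + 1)} [setLanguage.Structure S] (c : S → ZFSet.{u}) :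
    Prop where
  injective : Function.Injective c
  mem_iff : ∀ x : Fin 2 → S, Structure.RelMap memSymbol x ↔ c (x 0) ∈ c (x 1)
  transitive : ∀ x, ∀ y ∈ c x, ∃ s, c s = y

theorem isTransitiveModel_id : IsTransitiveModel (fun x : ZFSet.{u} => x) :=
  ⟨Function.injective_id, fun _ => Iff.rfl, fun _ y _ => ⟨y, rfl⟩⟩

theorem IsTransitiveClass.isTransitiveModel {M : Set ZFSet.{u}} (hM : IsTransitiveClass M) :
    IsTransitiveModel (fun x : M => (x : ZFSet.{u})) :=
  ⟨Subtype.val_injective, fun _ => Iff.rfl, fun x y hy => ⟨⟨y, hM x x.2 y hy⟩, rfl⟩⟩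

/-- Predicates of set variables that are expressed, in all transitive classes, by one
first-order formula. -/
class IsAbsolute (P : (ℕ → ZFSet.{u}) → Prop) : Prop where
  exists_formula : ∃ φ : setLanguage.Formula ℕ, ∀ (S : Type (u + 1)) [setLanguage.Structure S]
    (c : S → ZFSet.{u}), IsTransitiveModel c → ∀ v : ℕ → S, φ.Realize v ↔ P fun i => c (v i)

namespace IsAbsolute

instance mem (i k : ℕ) : IsAbsolute.{u} fun v => v i ∈ v k where
  exists_formula :=
    ⟨Relations.formula (L := setLanguage) memSymbol ![Term.var i, Term.var k], fun _ _ _ hc _ =>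
      Formula.realize_rel.trans (hc.mem_iff _)⟩

instance eq (i k : ℕ) : IsAbsolute.{u} fun v => v i = v k where
  exists_formula := ⟨Term.equal (Term.var i) (Term.var k), fun S _ c hc v => by
    rw [Formula.realize_equal]
    exact hc.injective.eq_iff.symm⟩

instance not (P : (ℕ → ZFSet.{u}) → Prop) [hP : IsAbsolute P] :
    IsAbsolute fun v => ¬ P v where
  exists_formula := by
    obtain ⟨φ, hφ⟩ := hP
    exact ⟨φ.not, fun S _ c hc v => by rw [Formula.realize_not, hφ S c hc]⟩

instance imp (P Q : (ℕ → ZFSet.{u}) → Prop) [hP : IsAbsolute P] [hQ : IsAbsolute Q] :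
    IsAbsolute fun v => P v → Q v where
  exists_formula := by
    obtain ⟨φ, hφ⟩ := hP
    obtain ⟨ψ, hψ⟩ := hQ
    exact ⟨φ.imp ψ, fun S _ c hc v => by rw [Formula.realize_imp, hφ S c hc, hψ S c hc]⟩

theorem congr {P Q : (ℕ → ZFSet.{u}) → Prop} (hP : IsAbsolute P) (h : ∀ v, P v ↔ Q v) :
    IsAbsolute Q := by
  rwa [← show P = Q from funext fun v => propext (h v)]

instance and (P Q : (ℕ → ZFSet.{u}) → Prop) [IsAbsolute P] [IsAbsolute Q] :
    IsAbsolute fun v => P v ∧ Q v :=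
  congr (P := fun v => ¬ (P v → ¬ Q v)) inferInstance fun v => by tauto

instance or (P Q : (ℕ → ZFSet.{u}) → Prop) [IsAbsolute P] [IsAbsolute Q] :
    IsAbsolute fun v => P v ∨ Q v :=
  congr (P := fun v => ¬ P v → Q v) inferInstance fun v => by tauto

instance iff (P Q : (ℕ → ZFSet.{u}) → Prop) [IsAbsolute P] [IsAbsolute Q] :
    IsAbsolute fun v => P v ↔ Q v :=
  congr (P := fun v => (P v → Q v) ∧ (Q v → P v)) inferInstance fun v => by tauto

/-- Renaming of the variables that makes the variable `0` the one to be quantified. -/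
def bindZero : ℕ → ℕ ⊕ Fin 1
  | 0 => Sum.inr 0
  | n + 1 => Sum.inl n

/-- The assignment `v` shifted by one place, with the new value `s` at `0`. -/
def consVar {S : Type*} (s : S) (v : ℕ → S) : ℕ → S
  | 0 => s
  | n + 1 => v n

theorem realize_bindZero {S : Type (u + 1)} [setLanguage.Structure S] (φ : setLanguage.Formula ℕ)
    (v : ℕ → S) : Formula.Realize ((BoundedFormula.relabel bindZero φ).all) v ↔
      ∀ s : S, φ.Realize (consVar s v) := by
  rw [Formula.Realize, BoundedFormula.realize_all]
  refine forall_congr' fun s => ?_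
  rw [BoundedFormula.realize_relabel, Formula.Realize]
  have h1 : (Sum.elim v ((Fin.snoc default s : Fin 1 → S) ∘ Fin.castAdd 0) ∘ bindZero)
      = (consVar s v) := by
    funext n
    cases n with
    | zero => simp [bindZero, consVar, Fin.snoc]
    | succ n => simp [bindZero, consVar]
  exact iff_of_eq (congrArg₂ (fun a b => BoundedFormula.Realize φ a b) h1 (Subsingleton.elim _ _))

/-- Elements of a set in a transitive class are in the class, so a bounded quantifier means the same
there as in V. With the connectives, instance search thus proves absoluteness of every Δ₀ predicate.
-/
instance ball (i : ℕ) (P : ZFSet.{u} → (ℕ → ZFSet.{u}) → Prop)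
    [hP : IsAbsolute fun v => P (v 0) (fun n => v (n + 1))] :
    IsAbsolute fun v => ∀ x, x ∈ v i → P x v where
  exists_formula := by
    obtain ⟨φ, hφ⟩ := (inferInstance :
      IsAbsolute fun v => v 0 ∈ v (i + 1) → P (v 0) (fun n => v (n + 1)))
    refine ⟨(BoundedFormula.relabel bindZero φ).all, fun S _ c hc v => ?_⟩
    rw [realize_bindZero]
    constructor
    · intro h x hx
      obtain ⟨s, rfl⟩ := hc.transitive _ _ hx
      exact (hφ S c hc _).1 (h s) hx
    · intro h s
      exact (hφ S c hc _).2 (h (c s))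

instance bex (i : ℕ) (P : ZFSet.{u} → (ℕ → ZFSet.{u}) → Prop)
    [hP : IsAbsolute fun v => P (v 0) (fun n => v (n + 1))] :
    IsAbsolute fun v => ∃ x, x ∈ v i ∧ P x v :=
  congr (P := fun v => ¬ ∀ x, x ∈ v i → ¬ P x v) inferInstance fun _ => by push Not; rfl

instance subset (i k : ℕ) : IsAbsolute.{u} fun v => v i ⊆ v k :=
  congr (P := fun v => ∀ x, x ∈ v i → x ∈ v k) inferInstance fun _ => Iff.rfl

instance eq_empty (i : ℕ) : IsAbsolute.{u} fun v => v i = ∅ :=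
  congr (P := fun v => ∀ x, x ∈ v i → ¬ x = x) inferInstance fun v => by
    rw [ZFSet.eq_empty]; simp

instance eq_insert (i k l : ℕ) : IsAbsolute.{u} fun v => v i = insert (v k) (v l) :=
  congr (P := fun v => v k ∈ v i ∧ (∀ x, x ∈ v l → x ∈ v i) ∧
      ∀ x, x ∈ v i → x = v k ∨ x ∈ v l) inferInstance fun v => by
    constructor
    · rintro ⟨h1, h2, h3⟩
      ext x
      rw [ZFSet.mem_insert_iff]
      exact ⟨h3 x, by rintro (rfl | h); exacts [h1, h2 x h]⟩
    · intro h
      simp only [h, ZFSet.mem_insert_iff]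
      tauto

instance eq_singleton (i k : ℕ) : IsAbsolute.{u} fun v => v i = {v k} :=
  congr (P := fun v => v k ∈ v i ∧ ∀ x, x ∈ v i → x = v k) inferInstance fun v => by
    constructor
    · rintro ⟨h1, h2⟩
      ext x
      rw [ZFSet.mem_singleton]
      exact ⟨h2 x, by rintro rfl; exact h1⟩
    · intro h
      simp [h]

instance eq_doubleton (i k l : ℕ) : IsAbsolute.{u} fun v => v i = {v k, v l} :=
  congr (P := fun v => v k ∈ v i ∧ v l ∈ v i ∧ ∀ x, x ∈ v i → x = v k ∨ x = v l)
    inferInstance fun v => by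
    constructor
    · rintro ⟨h1, h2, h3⟩
      ext x
      rw [ZFSet.mem_pair]
      exact ⟨h3 x, by rintro (rfl | rfl); exacts [h1, h2]⟩
    · intro h
      simp [h]

instance eq_pair (i k l : ℕ) : IsAbsolute.{u} fun v => v i = ZFSet.pair (v k) (v l) :=
  congr (P := fun v => (∃ x, x ∈ v i ∧ x = {v k}) ∧ (∃ x, x ∈ v i ∧ x = {v k, v l}) ∧
      ∀ x, x ∈ v i → x = {v k} ∨ x = {v k, v l}) inferInstance fun v => by
    constructor
    · rintro ⟨⟨_, h1, rfl⟩, ⟨_, h2, rfl⟩, h3⟩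
      ext x
      rw [ZFSet.pair, ZFSet.mem_pair]
      exact ⟨h3 x, by rintro (rfl | rfl); exacts [h1, h2]⟩
    · intro h
      simp [h, ZFSet.pair]

instance pair_mem (i k l : ℕ) : IsAbsolute.{u} fun v => ZFSet.pair (v k) (v l) ∈ v i :=
  congr (P := fun v => ∃ x, x ∈ v i ∧ x = ZFSet.pair (v k) (v l)) inferInstance fun v => by
    simp

end IsAbsolute

/-! ### Transfer along elementary embeddings -/

/-- `j` is an elementary embedding of `V` into the transitive class `M`. -/
structure IsElementaryMap (M : Set ZFSet.{u}) (j : ZFSet.{u} → ZFSet.{u}) : Prop where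
  transitive : IsTransitiveClass M
  exists_embedding : ∃ J : ElementaryEmbedding setLanguage ZFSet.{u} M, ∀ x, (J x : ZFSet.{u}) = j x

theorem StrongnessEmbedding.isElementaryMap {κ : Cardinal.{u}} {θ : Ordinal.{u}}
    (e : StrongnessEmbedding κ θ) : IsElementaryMap e.M fun x => e.j x :=
  ⟨e.transitive, e.j, fun _ => rfl⟩

namespace IsElementaryMap

variable {M : Set ZFSet.{u}} {j : ZFSet.{u} → ZFSet.{u}}

theorem apply_mem (hj : IsElementaryMap M j) (x : ZFSet.{u}) : j x ∈ M := by
  obtain ⟨J, hJ⟩ := hj.exists_embedding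
  rw [← hJ]
  exact (J x).2

theorem transfer (hj : IsElementaryMap M j) (P : (ℕ → ZFSet.{u}) → Prop) [hP : IsAbsolute P]
    (v : ℕ → ZFSet.{u}) : P v ↔ P fun i => j (v i) := by
  obtain ⟨J, hJ⟩ := hj.exists_embedding
  obtain ⟨φ, hφ⟩ := hP
  have h := J.map_formula φ v
  rw [hφ _ _ isTransitiveModel_id v, hφ _ _ hj.transitive.isTransitiveModel] at h
  rw [← h]
  simp only [Function.comp_apply, hJ]

/-- One unbounded quantifier in front of a Δ₀ formula is still transferred, but it becomes relative
to M. -/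
theorem transfer_forall (hj : IsElementaryMap M j) (P : ZFSet.{u} → (ℕ → ZFSet.{u}) → Prop)
    [hP : IsAbsolute fun v => P (v 0) (fun n => v (n + 1))]
    (v : ℕ → ZFSet.{u}) : (∀ x, P x v) ↔ ∀ x ∈ M, P x fun i => j (v i) := by
  obtain ⟨J, hJ⟩ := hj.exists_embedding
  obtain ⟨φ, hφ⟩ := hP
  have h := J.map_formula (BoundedFormula.relabel IsAbsolute.bindZero φ).all v
  rw [IsAbsolute.realize_bindZero, IsAbsolute.realize_bindZero] at h
  simp only [hφ _ _ isTransitiveModel_id, hφ _ _ hj.transitive.isTransitiveModel,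
    IsAbsolute.consVar, Function.comp_apply, hJ] at h
  rw [← h, Subtype.forall]

theorem pair_mem (hj : IsElementaryMap M j) {a b : ZFSet.{u}} (ha : a ∈ M) (hb : b ∈ M) :
    ZFSet.pair a b ∈ M := by
  obtain ⟨J, hJ⟩ := hj.exists_embedding
  obtain ⟨φ, hφ⟩ := (inferInstance : IsAbsolute.{u} fun v => ¬ v 0 = ZFSet.pair (v 1) (v 2))
  -- The formula says ∀ b ∀ a ¬∀ x ¬(x = (a, b)); its truth in V passes to M, and the pair computed
  -- in M is the true one.
  have h := J.map_formula (BoundedFormula.relabel IsAbsolute.bindZero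
    (BoundedFormula.relabel IsAbsolute.bindZero
      (BoundedFormula.relabel IsAbsolute.bindZero φ).all.not).all).all (fun _ => ∅)
  have hb' : Formula.not (BoundedFormula.relabel IsAbsolute.bindZero φ).all =
    (BoundedFormula.relabel IsAbsolute.bindZero φ).all.not := rfl
  simp only [IsAbsolute.realize_bindZero, ← hb', Formula.realize_not,
    hφ _ _ isTransitiveModel_id, hφ _ _ hj.transitive.isTransitiveModel,
    IsAbsolute.consVar, not_forall, not_not] at h
  obtain ⟨x, hx⟩ := h.2 (fun a b => ⟨_, rfl⟩) ⟨b, hb⟩ ⟨a, ha⟩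
  rw [← hx]
  exact x.2

theorem transfer₂ (hj : IsElementaryMap M j)
    (P : ZFSet.{u} → ZFSet.{u} → Prop) [IsAbsolute fun v => P (v 0) (v 1)]
    (a b : ZFSet.{u}) : P a b ↔ P (j a) (j b) :=
  -- The variables that do not occur get the junk value ∅.
  hj.transfer (fun v => P (v 0) (v 1)) fun n => [a, b].getD n ∅

theorem transfer₃ (hj : IsElementaryMap M j)
    (P : ZFSet.{u} → ZFSet.{u} → ZFSet.{u} → Prop)
    [IsAbsolute fun v => P (v 0) (v 1) (v 2)]
    (a b c : ZFSet.{u}) : P a b c ↔ P (j a) (j b) (j c) :=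
  hj.transfer (fun v => P (v 0) (v 1) (v 2)) fun n => [a, b, c].getD n ∅

theorem transfer₄ (hj : IsElementaryMap M j)
    (P : ZFSet.{u} → ZFSet.{u} → ZFSet.{u} → ZFSet.{u} → Prop)
    [IsAbsolute fun v => P (v 0) (v 1) (v 2) (v 3)]
    (a b c d : ZFSet.{u}) : P a b c d ↔ P (j a) (j b) (j c) (j d) :=
  hj.transfer (fun v => P (v 0) (v 1) (v 2) (v 3)) fun n => [a, b, c, d].getD n ∅

theorem transfer₅ (hj : IsElementaryMap M j)
    (P : ZFSet.{u} → ZFSet.{u} → ZFSet.{u} → ZFSet.{u} → ZFSet.{u} → Prop)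
    [IsAbsolute fun v => P (v 0) (v 1) (v 2) (v 3) (v 4)]
    (a b c d f : ZFSet.{u}) : P a b c d f ↔ P (j a) (j b) (j c) (j d) (j f) :=
  hj.transfer (fun v => P (v 0) (v 1) (v 2) (v 3) (v 4)) fun n => [a, b, c, d, f].getD n ∅

theorem transfer₆ (hj : IsElementaryMap M j)
    (P : ZFSet.{u} → ZFSet.{u} → ZFSet.{u} → ZFSet.{u} → ZFSet.{u} → ZFSet.{u} → Prop)
    [IsAbsolute fun v => P (v 0) (v 1) (v 2) (v 3) (v 4) (v 5)]
    (a b c d f g : ZFSet.{u}) : P a b c d f g ↔ P (j a) (j b) (j c) (j d) (j f) (j g) :=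
  hj.transfer (fun v => P (v 0) (v 1) (v 2) (v 3) (v 4) (v 5)) fun n => [a, b, c, d, f, g].getD n ∅

theorem transfer₈ (hj : IsElementaryMap M j)
    (P : ZFSet.{u} → ZFSet.{u} → ZFSet.{u} → ZFSet.{u} → ZFSet.{u} → ZFSet.{u} → ZFSet.{u} →
      ZFSet.{u} → Prop)
    [IsAbsolute fun v => P (v 0) (v 1) (v 2) (v 3) (v 4) (v 5) (v 6) (v 7)]
    (a b c d f g h k : ZFSet.{u}) :
    P a b c d f g h k ↔ P (j a) (j b) (j c) (j d) (j f) (j g) (j h) (j k) :=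
  hj.transfer (fun v => P (v 0) (v 1) (v 2) (v 3) (v 4) (v 5) (v 6) (v 7)) fun n =>
    [a, b, c, d, f, g, h, k].getD n ∅

theorem mem_iff (hj : IsElementaryMap M j) {a b : ZFSet.{u}} : j a ∈ j b ↔ a ∈ b :=
  (hj.transfer₂ (fun a b => a ∈ b) a b).symm

theorem subset_iff (hj : IsElementaryMap M j) {a b : ZFSet.{u}} : j a ⊆ j b ↔ a ⊆ b :=
  (hj.transfer₂ (fun a b => a ⊆ b) a b).symm

theorem map_pair (hj : IsElementaryMap M j) (a b : ZFSet.{u}) : j (ZFSet.pair a b) = ZFSet.pair (j a) (j b) :=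
  (hj.transfer₃ (fun a b c => c = ZFSet.pair a b) a b _).1 rfl

end IsElementaryMap
end StrongLaver

/-! ### Set functions and the cumulative hierarchy under elementary embeddings -/

namespace StrongLaver

/-- The set of all `f x` with `x ∈ A`. -/
noncomputable def imageOn (A : ZFSet.{u}) (f : ZFSet.{u} → ZFSet.{u}) : ZFSet.{u} :=
  ZFSet.range fun x : {x // x ∈ A} => f x

/-- The restriction of the class function `f` to the set `A`, as a set of pairs. -/
noncomputable def graphOn (A : ZFSet.{u}) (f : ZFSet.{u} → ZFSet.{u}) : ZFSet.{u} :=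
  ZFSet.range fun x : {x // x ∈ A} => ZFSet.pair x (f x)

theorem mem_imageOn {A y : ZFSet.{u}} {f : ZFSet.{u} → ZFSet.{u}} :
    y ∈ imageOn A f ↔ ∃ x ∈ A, f x = y := by
  simp [imageOn]

theorem mem_graphOn {A z : ZFSet.{u}} {f : ZFSet.{u} → ZFSet.{u}} :
    z ∈ graphOn A f ↔ ∃ x ∈ A, ZFSet.pair x (f x) = z := by
  simp [graphOn]

theorem pair_mem_graphOn {A x y : ZFSet.{u}} {f : ZFSet.{u} → ZFSet.{u}} :
    ZFSet.pair x y ∈ graphOn A f ↔ x ∈ A ∧ f x = y := by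
  rw [mem_graphOn]
  constructor
  · rintro ⟨z, hz, h⟩
    obtain ⟨rfl, rfl⟩ := ZFSet.pair_inj.1 h
    exact ⟨hz, rfl⟩
  · rintro ⟨hx, rfl⟩
    exact ⟨x, hx, rfl⟩

theorem pair_mem_vonNeumann {o : Ordinal.{u}} (ho : Order.IsSuccLimit o) {a b : ZFSet.{u}} :
    ZFSet.pair a b ∈ V_ o ↔ a ∈ V_ o ∧ b ∈ V_ o := by
  simp only [ZFSet.mem_vonNeumann, ZFSet.pair, ZFSet.rank_pair, ZFSet.rank_singleton, max_lt_iff,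
    ho.succ_lt_iff]
  tauto

theorem toZFSet_mem_vonNeumann {o a : Ordinal.{u}} : a.toZFSet ∈ V_ o ↔ a < o := by
  rw [ZFSet.mem_vonNeumann, Ordinal.rank_toZFSet]

theorem toZFSet_succ (a : Ordinal.{u}) :
    (Order.succ a).toZFSet = insert a.toZFSet a.toZFSet := by
  rw [Order.succ_eq_add_one, Ordinal.toZFSet_add_one]

instance IsAbsolute.isOrdinal (i : ℕ) : IsAbsolute.{u} fun v => ZFSet.IsOrdinal (v i) :=
  IsAbsolute.congr (P := fun v => (∀ x, x ∈ v i → ∀ y, y ∈ x → y ∈ v i) ∧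
      ∀ x, x ∈ v i → ∀ y, y ∈ x → ∀ z, z ∈ y → z ∈ x) inferInstance fun v => by
    constructor
    · rintro ⟨h1, h2⟩
      exact ⟨fun x hx y hy => h1 x hx y hy, fun hx hy hz => h2 _ hz _ hy _ hx⟩
    · intro h
      exact ⟨fun x hx y hy => h.mem_trans hy hx, fun x hx y hy z hz => (h.mem hx).mem_trans hz hy⟩

namespace IsElementaryMap

variable {M : Set ZFSet.{u}} {j : ZFSet.{u} → ZFSet.{u}}

theorem map_empty (hj : IsElementaryMap M j) : j ∅ = ∅ :=
  (hj.transfer₂ (fun a _ => a = ∅) ∅ ∅).1 rfl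

theorem isOrdinal_map (hj : IsElementaryMap M j) (o : Ordinal.{u}) :
    ZFSet.IsOrdinal (j o.toZFSet) :=
  (hj.transfer₂ (fun a _ => ZFSet.IsOrdinal a) _ ∅).1 (ZFSet.isOrdinal_toZFSet o)

theorem isTransitive_map (hj : IsElementaryMap M j) {x : ZFSet.{u}} (hx : x.IsTransitive) :
    (j x).IsTransitive :=
  (hj.transfer₂ (fun a _ => ∀ y ∈ a, y ⊆ a) x ∅).1 hx

/-- The image of f serves here and below to bound the quantifiers over values of f, which keeps the
transferred formulas Δ₀. -/
theorem mem_of_pair_mem_map_graphOn (hj : IsElementaryMap M j) {A x y : ZFSet.{u}}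
    {f : ZFSet.{u} → ZFSet.{u}} (h : ZFSet.pair x y ∈ j (graphOn A f)) :
    x ∈ j A ∧ y ∈ j (imageOn A f) := by
  have := (hj.transfer₃ (fun A B G => ∀ p ∈ G, ∃ x ∈ A, ∃ y ∈ B, p = ZFSet.pair x y)
    A (imageOn A f) (graphOn A f)).1 fun p hp => by
      obtain ⟨x, hx, rfl⟩ := mem_graphOn.1 hp
      exact ⟨x, hx, f x, mem_imageOn.2 ⟨x, hx, rfl⟩, rfl⟩
  obtain ⟨x', hx, y', hy, h⟩ := this _ h
  obtain ⟨rfl, rfl⟩ := ZFSet.pair_inj.1 h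
  exact ⟨hx, hy⟩

theorem map_graphOn_unique (hj : IsElementaryMap M j) {A x y z : ZFSet.{u}}
    {f : ZFSet.{u} → ZFSet.{u}} (hy : ZFSet.pair x y ∈ j (graphOn A f))
    (hz : ZFSet.pair x z ∈ j (graphOn A f)) : y = z := by
  have := (hj.transfer₃ (fun A B G => ∀ x ∈ A, ∀ y ∈ B, ∀ z ∈ B, ZFSet.pair x y ∈ G →
    ZFSet.pair x z ∈ G → y = z) A (imageOn A f) (graphOn A f)).1 fun x hx y _ z _ h1 h2 =>
      (pair_mem_graphOn.1 h1).2.symm.trans (pair_mem_graphOn.1 h2).2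
  obtain ⟨h1, h2⟩ := hj.mem_of_pair_mem_map_graphOn hy
  exact this x h1 y h2 z (hj.mem_of_pair_mem_map_graphOn hz).2 hy hz

theorem exists_pair_mem_map_graphOn (hj : IsElementaryMap M j) {A x : ZFSet.{u}}
    (f : ZFSet.{u} → ZFSet.{u}) (hx : x ∈ j A) : ∃ y, ZFSet.pair x y ∈ j (graphOn A f) := by
  have := (hj.transfer₃ (fun A B G => ∀ x ∈ A, ∃ y ∈ B, ZFSet.pair x y ∈ G)
    A (imageOn A f) (graphOn A f)).1 fun x hx =>
      ⟨f x, mem_imageOn.2 ⟨x, hx, rfl⟩, pair_mem_graphOn.2 ⟨hx, rfl⟩⟩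
  obtain ⟨y, -, h⟩ := this x hx
  exact ⟨y, h⟩

theorem pair_mem_map_graphOn (hj : IsElementaryMap M j) {A x : ZFSet.{u}}
    (f : ZFSet.{u} → ZFSet.{u}) (hx : x ∈ A) : ZFSet.pair (j x) (j (f x)) ∈ j (graphOn A f) := by
  rw [← hj.map_pair, hj.mem_iff]
  exact pair_mem_graphOn.2 ⟨hx, rfl⟩

/-- The elements of `j(V_o)` have rank below `j(o)`. -/
theorem rank_lt_of_mem_map_vonNeumann (hj : IsElementaryMap M j) {o : Ordinal.{u}} {x : ZFSet.{u}}
    (hx : x ∈ j (V_ o)) : x.rank < (j o.toZFSet).rank := by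
  set G := graphOn (V_ o) (fun x => x.rank.toZFSet) with hG
  have h1 := (hj.transfer₃ (fun V O G => ∀ x ∈ V, ∀ r ∈ O, ZFSet.pair x r ∈ G → ∀ y ∈ x,
    ∃ s ∈ r, ZFSet.pair y s ∈ G) (V_ o) o.toZFSet G).1 fun x hx r _ h y hy => by
      obtain ⟨-, rfl⟩ := pair_mem_graphOn.1 h
      exact ⟨_, Ordinal.toZFSet_mem_toZFSet_iff.2 (ZFSet.rank_lt_of_mem hy), pair_mem_graphOn.2
        ⟨ZFSet.isTransitive_vonNeumann o x hx hy, rfl⟩⟩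
  have h2 := (hj.transfer₃ (fun V O G => ∀ x ∈ V, ∃ r ∈ O, ZFSet.pair x r ∈ G)
    (V_ o) o.toZFSet G).1 fun x hx => ⟨_, Ordinal.toZFSet_mem_toZFSet_iff.2
      (ZFSet.mem_vonNeumann.1 hx), pair_mem_graphOn.2 ⟨hx, rfl⟩⟩
  have ho := hj.isOrdinal_map o
  -- The function j(G) strictly decreases along ∈, so by induction its values dominate the true
  -- ranks.
  have key : ∀ x r : ZFSet.{u}, x ∈ j (V_ o) → r ∈ j o.toZFSet → ZFSet.pair x r ∈ j G →
      x.rank ≤ r.rank := by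
    intro x
    induction x using ZFSet.inductionOn with
    | h x ih =>
      intro r hx hr h
      rw [ZFSet.rank_le_iff]
      intro y hy
      obtain ⟨s, hs, h'⟩ := h1 x hx r hr h y hy
      exact (ih y hy s (hj.isTransitive_map (ZFSet.isTransitive_vonNeumann o) x hx hy)
        (ho.mem_trans hs hr) h').trans_lt (ZFSet.rank_lt_of_mem hs)
  obtain ⟨r, hr, h⟩ := h2 x hx
  exact (key x r hx hr h).trans_lt (ZFSet.rank_lt_of_mem hr)

/-- If `θ < j(o)` then the members of `M` of rank below `θ` are in `j(V_o)`. -/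
theorem mem_map_vonNeumann (hj : IsElementaryMap M j) {o θ : Ordinal.{u}}
    (hθ : θ.toZFSet ∈ j o.toZFSet) {x : ZFSet.{u}} (hx : x ∈ M) (hr : x.rank < θ) :
    x ∈ j (V_ o) := by
  set G := graphOn o.toZFSet (fun x => V_ x.rank) with hG
  have hV : ∀ a : Ordinal.{u}, ∀ x, ZFSet.pair a.toZFSet x ∈ G ↔ a < o ∧ x = V_ a := by
    intro a x
    rw [hG, pair_mem_graphOn, Ordinal.rank_toZFSet, Ordinal.toZFSet_mem_toZFSet_iff, eq_comm]
  have hto : ∀ b ∈ o.toZFSet, ∃ a < o, a.toZFSet = b := fun b hb => Ordinal.mem_toZFSet_iff.1 hb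
  have h1 := (hj.transfer₃ (fun V O G => ∀ b ∈ O, ∃ w ∈ V, ZFSet.pair b w ∈ G)
    (V_ o) o.toZFSet G).1 fun b hb => by
      obtain ⟨a, ha, rfl⟩ := hto b hb
      exact ⟨_, ZFSet.vonNeumann_mem_of_lt ha, (hV _ _).2 ⟨ha, rfl⟩⟩
  -- Each stage contains every subset of every earlier stage. Here x ranges over the whole universe,
  -- hence over M after the transfer.
  have h2 := (hj.transfer_forall (fun x v => ∀ b, b ∈ v 0 → ∀ w, w ∈ v 1 →
      ZFSet.pair b w ∈ v 2 → (∃ c, c ∈ b ∧ ∃ w', w' ∈ v 1 ∧ ZFSet.pair c w' ∈ v 2 ∧ x ⊆ w') →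
      x ∈ w) fun n => [o.toZFSet, V_ o, G].getD n ∅).1 (by
    rintro x b hb w - hw ⟨c, hc, w', -, hw', hx⟩
    obtain ⟨a, ha, rfl⟩ := hto b hb
    obtain ⟨d, hd, rfl⟩ := Ordinal.mem_toZFSet_iff.1 hc
    obtain ⟨-, rfl⟩ := (hV _ _).1 hw
    obtain ⟨-, rfl⟩ := (hV _ _).1 hw'
    exact ZFSet.mem_vonNeumann'.2 ⟨d, hd, hx⟩)
  have ho := hj.isOrdinal_map o
  have key : ∀ b : Ordinal.{u}, b.toZFSet ∈ j o.toZFSet → ∀ w ∈ j (V_ o),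
      ZFSet.pair b.toZFSet w ∈ j G → ∀ x ∈ M, x.rank < b → x ∈ w := by
    intro b
    induction b using WellFoundedLT.induction with
    | ind b ih =>
      intro hb w hw hbw x hx hxb
      have hc := Ordinal.toZFSet_mem_toZFSet_iff.2 hxb
      obtain ⟨w', hw', hcw⟩ := h1 _ (ho.mem_trans hc hb)
      exact h2 x hx _ hb w hw hbw ⟨_, hc, w', hw', hcw, fun y hy =>
        ih _ hxb (ho.mem_trans hc hb) w' hw' hcw y (hj.transitive x hx y hy)
          (ZFSet.rank_lt_of_mem hy)⟩
  obtain ⟨w, hw, hθw⟩ := h1 _ hθ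
  exact hj.isTransitive_map (ZFSet.isTransitive_vonNeumann o) w hw (key θ hθ w hw hθw x hx hr)

end IsElementaryMap

/-! ### The critical point of a strongness embedding -/

namespace StrongnessEmbedding

variable {κ : Cardinal.{u}} {θ : Ordinal.{u}} (e : StrongnessEmbedding κ θ)

/-- The embedding `j`, as a map from `V` to `V`. -/
def map (x : ZFSet.{u}) : ZFSet.{u} := e.j x

theorem isElementaryMap_map : IsElementaryMap e.M e.map := e.isElementaryMap

theorem map_toZFSet {a : Ordinal.{u}} (ha : a < κ.ord) : e.map a.toZFSet = a.toZFSet :=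
  e.fix_below a ha

/-- By induction on a: an element of V_a is a subset of some V_b with b < a, on which j is the
identity, so j fixes it. And j(V_a) is covered by the stages with index in j(a) = a, which j fixes
as well. -/
theorem map_vonNeumann (a : Ordinal.{u}) (ha : a < κ.ord) :
    e.map (V_ a) = V_ a ∧ ∀ x ∈ V_ a, e.map x = x := by
  have hj := e.isElementaryMap_map
  induction a using WellFoundedLT.induction with
  | ind a ih =>
    have hfix : ∀ x ∈ V_ a, e.map x = x := by
      intro x hx
      obtain ⟨b, hb, hxb⟩ := ZFSet.mem_vonNeumann'.1 hx
      obtain ⟨h1, h2⟩ := ih b hb (hb.trans ha)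
      ext z
      constructor
      · intro hz
        have hzb : z ∈ V_ b := by
          rw [← h1]
          exact hj.subset_iff.2 hxb hz
        rwa [← h2 z hzb, hj.mem_iff] at hz
      · intro hz
        rw [← h2 z (hxb hz)]
        exact hj.mem_iff.2 hz
    refine ⟨?_, hfix⟩
    set G := graphOn a.toZFSet (fun x => V_ x.rank) with hG
    have h1 := (hj.transfer₃ (fun V O G => ∀ x ∈ V, ∃ b ∈ O, ∃ w ∈ V, ZFSet.pair b w ∈ G ∧ x ⊆ w)
      (V_ a) a.toZFSet G).1 fun x hx => by
        obtain ⟨b, hb, hxb⟩ := ZFSet.mem_vonNeumann'.1 hx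
        exact ⟨b.toZFSet, Ordinal.toZFSet_mem_toZFSet_iff.2 hb, _, ZFSet.vonNeumann_mem_of_lt hb,
          pair_mem_graphOn.2 ⟨Ordinal.toZFSet_mem_toZFSet_iff.2 hb, by rw [Ordinal.rank_toZFSet]⟩, hxb⟩
    ext x
    constructor
    · intro hx
      obtain ⟨b, hb, w, hw, hbw, hxw⟩ := h1 x hx
      rw [e.map_toZFSet ha] at hb
      obtain ⟨b, hba, rfl⟩ := Ordinal.mem_toZFSet_iff.1 hb
      have h2 := hj.pair_mem_map_graphOn (fun x => V_ x.rank) hb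
      rw [e.map_toZFSet (hba.trans ha), Ordinal.rank_toZFSet, (ih b hba (hba.trans ha)).1] at h2
      rw [hj.map_graphOn_unique hbw h2] at hxw
      exact ZFSet.mem_vonNeumann'.2 ⟨b, hba, hxw⟩
    · intro hx
      rw [← hfix x hx]
      exact hj.mem_iff.2 hx

theorem isSuccLimit_ord (e : StrongnessEmbedding κ θ) : Order.IsSuccLimit κ.ord := by
  have hj := e.isElementaryMap_map
  rcases Ordinal.zero_or_succ_or_isSuccLimit κ.ord with h | ⟨a, ha⟩ | h
  · refine absurd hj.map_empty ?_
    have := e.move_crit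
    rwa [h, Ordinal.toZFSet_zero] at this
  · have hlt : a < κ.ord := ha ▸ Order.lt_succ a
    have h1 := (hj.transfer₂ (fun x y => x = insert y y) (Order.succ a).toZFSet a.toZFSet).1
      (toZFSet_succ a)
    rw [e.map_toZFSet hlt, ← toZFSet_succ] at h1
    refine absurd ?_ e.move_crit
    rw [← ha]
    exact h1
  · exact h

theorem map_of_mem {x : ZFSet.{u}} (hx : x ∈ V_ κ.ord) : e.map x = x := by
  have h := e.isSuccLimit_ord.succ_lt (ZFSet.mem_vonNeumann.1 hx)
  exact (e.map_vonNeumann _ h).2 x (ZFSet.mem_vonNeumann_succ x)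

theorem crit_mem_map : κ.ord.toZFSet ∈ e.map κ.ord.toZFSet := by
  have hj := e.isElementaryMap_map
  have hs : κ.ord.toZFSet ⊆ e.map κ.ord.toZFSet := by
    intro x hx
    obtain ⟨a, ha, rfl⟩ := Ordinal.mem_toZFSet_iff.1 hx
    rw [← e.map_toZFSet ha]
    exact hj.mem_iff.2 hx
  rcases ((ZFSet.isOrdinal_toZFSet _).subset_iff_eq_or_mem (hj.isOrdinal_map _)).1 hs with h | h
  · exact absurd h.symm e.move_crit
  · exact h

/-- A function from an element of `V_κ` to `κ` is bounded. -/
theorem exists_bound (e : StrongnessEmbedding κ θ) {A : ZFSet.{u}} (hA : A ∈ V_ κ.ord) (g : ZFSet.{u} → Ordinal.{u})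
    (hg : ∀ x ∈ A, g x < κ.ord) : ∃ b < κ.ord, ∀ x ∈ A, g x < b := by
  have hj := e.isElementaryMap_map
  by_contra! hcon
  set G := graphOn A (fun x => (g x).toZFSet) with hG
  -- If g were unbounded in κ, then j(g) would be unbounded in j(κ), and thus reach κ at some x in
  -- j(A) = A, where j(g)(x) = g(x) < κ.
  have h1 := (hj.transfer₃ (fun A O G => ∀ b ∈ O, ∃ x ∈ A, ∃ c ∈ O, ZFSet.pair x c ∈ G ∧ b ⊆ c)
    A κ.ord.toZFSet G).1 fun b hb => by
      obtain ⟨b, hbκ, rfl⟩ := Ordinal.mem_toZFSet_iff.1 hb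
      obtain ⟨x, hx, hbx⟩ := hcon b hbκ
      exact ⟨x, hx, (g x).toZFSet, Ordinal.toZFSet_mem_toZFSet_iff.2 (hg x hx),
        pair_mem_graphOn.2 ⟨hx, rfl⟩, Ordinal.toZFSet_subset_toZFSet_iff.2 hbx⟩
  obtain ⟨x, hx, c, -, hxc, hc⟩ := h1 _ e.crit_mem_map
  rw [e.map_of_mem hA] at hx
  have h2 := hj.pair_mem_map_graphOn (fun x => (g x).toZFSet) hx
  rw [e.map_of_mem (ZFSet.isTransitive_vonNeumann _ A hA hx), e.map_toZFSet (hg x hx)] at h2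
  rw [hj.map_graphOn_unique hxc h2, Ordinal.toZFSet_subset_toZFSet_iff] at hc
  exact (hg x hx).not_ge hc

/-- If κ were ω, all its elements, and hence those of j(κ), would be zero or successors; but κ is a
limit and κ ∈ j(κ). -/
theorem aleph0_lt (e : StrongnessEmbedding κ θ) : Cardinal.aleph0 < κ := by
  have hj := e.isElementaryMap_map
  have hlim := e.isSuccLimit_ord
  refine lt_of_le_of_ne ?_ ?_
  · have := Ordinal.omega0_le_of_isSuccLimit hlim
    rwa [← Cardinal.ord_aleph0, Cardinal.ord_le_ord] at this
  · intro h
    have h1 := (hj.transfer₂ (fun O E => ∀ x ∈ O, x = ∅ ∨ ∃ y ∈ x, x = insert y y)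
      κ.ord.toZFSet ∅).1 fun x hx => by
        obtain ⟨a, ha, rfl⟩ := Ordinal.mem_toZFSet_iff.1 hx
        rw [← h, Cardinal.ord_aleph0, Ordinal.lt_omega0] at ha
        obtain ⟨n, rfl⟩ := ha
        cases n with
        | zero => left; simp
        | succ n =>
          right
          refine ⟨(n : Ordinal.{u}).toZFSet, ?_, ?_⟩
          · rw [Ordinal.toZFSet_mem_toZFSet_iff]; exact_mod_cast n.lt_succ_self
          · rw [← toZFSet_succ]; simp
    rcases h1 _ e.crit_mem_map with h0 | ⟨y, hy, h2⟩
    · rw [← Ordinal.toZFSet_zero] at h0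
      exact hlim.bot_lt.ne' (Ordinal.toZFSet_injective h0)
    · obtain ⟨a, ha, rfl⟩ := Ordinal.mem_toZFSet_iff.1 hy
      rw [← toZFSet_succ] at h2
      exact (hlim.succ_lt ha).ne' (Ordinal.toZFSet_injective h2)

/-- In general |V_{ω+θ}| = ℶ_θ. The shift by ω is absorbed because κ is uncountable, so θ ≥ ω·ω. -/
theorem card_vonNeumann_eq_beth (e : StrongnessEmbedding κ θ) (h : κ.ord ≤ θ) :
    (V_ θ).card = Cardinal.beth θ := by
  have h1 : Ordinal.omega0 * Ordinal.omega0 ≤ θ := by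
    refine le_trans (le_of_lt ?_) h
    rw [Cardinal.lt_ord, Ordinal.card_mul, Ordinal.card_omega0, Cardinal.aleph0_mul_aleph0]
    exact e.aleph0_lt
  have h2 : Ordinal.omega0 + θ = θ := by
    obtain ⟨c, rfl⟩ := exists_add_of_le h1
    rw [← add_assoc, ← mul_one_add, Ordinal.one_add_omega0]
  rw [ZFSet.card_vonNeumann, Cardinal.beth, h2]

theorem mem_map_vonNeumann {x : ZFSet.{u}} (hθ : θ.toZFSet ∈ e.map κ.ord.toZFSet)
    (hx : x ∈ V_ θ) : x ∈ e.map (V_ κ.ord) :=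
  e.isElementaryMap_map.mem_map_vonNeumann hθ (e.strong x hx) (ZFSet.mem_vonNeumann.1 hx)

end StrongnessEmbedding
end StrongLaver

/-! ### Łoś's theorem for atomic formulas and the transitive collapse -/

namespace StrongLaver

theorem graphOn_congr {A : ZFSet.{u}} {f g : ZFSet.{u} → ZFSet.{u}} (h : ∀ x ∈ A, f x = g x) :
    graphOn A f = graphOn A g := by
  ext z
  simp only [mem_graphOn]
  exact exists_congr fun x => and_congr_right fun hx => by rw [h x hx]

open Classical in
/-- The first component of an ordered pair. -/
noncomputable def fst (z : ZFSet.{u}) : ZFSet.{u} :=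
  if h : ∃ x y, z = ZFSet.pair x y then h.choose else ∅

open Classical in
/-- The second component of an ordered pair. -/
noncomputable def snd (z : ZFSet.{u}) : ZFSet.{u} :=
  if h : ∃ y x, z = ZFSet.pair x y then h.choose else ∅

@[simp]
theorem fst_pair (x y : ZFSet.{u}) : fst (ZFSet.pair x y) = x := by
  have h : ∃ x' y', ZFSet.pair x y = ZFSet.pair x' y' := ⟨x, y, rfl⟩
  rw [fst, dif_pos h]
  obtain ⟨y', hy⟩ := h.choose_spec
  exact (ZFSet.pair_inj.1 hy).1.symm

@[simp]
theorem snd_pair (x y : ZFSet.{u}) : snd (ZFSet.pair x y) = y := by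
  have h : ∃ y' x', ZFSet.pair x y = ZFSet.pair x' y' := ⟨y, x, rfl⟩
  rw [snd, dif_pos h]
  obtain ⟨x', hx⟩ := h.choose_spec
  exact (ZFSet.pair_inj.1 hx).2.symm

/-- The value `j(f ↾ A)(a)`. -/
noncomputable def evalMap (j : ZFSet.{u} → ZFSet.{u}) (A : ZFSet.{u}) (f : ZFSet.{u} → ZFSet.{u})
    (a : ZFSet.{u}) : ZFSet.{u} :=
  Classical.epsilon fun y => ZFSet.pair a y ∈ j (graphOn A f)

namespace IsElementaryMap

variable {M : Set ZFSet.{u}} {j : ZFSet.{u} → ZFSet.{u}} {A a b : ZFSet.{u}}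

theorem pair_evalMap_mem (hj : IsElementaryMap M j) (f : ZFSet.{u} → ZFSet.{u}) (ha : a ∈ j A) :
    ZFSet.pair a (evalMap j A f a) ∈ j (graphOn A f) :=
  Classical.epsilon_spec (hj.exists_pair_mem_map_graphOn f ha)

theorem evalMap_eq (hj : IsElementaryMap M j) {f : ZFSet.{u} → ZFSet.{u}} {y : ZFSet.{u}}
    (h : ZFSet.pair a y ∈ j (graphOn A f)) : evalMap j A f a = y :=
  hj.map_graphOn_unique (hj.pair_evalMap_mem f (hj.mem_of_pair_mem_map_graphOn h).1) h

theorem evalMap_mem_imageOn (hj : IsElementaryMap M j) (f : ZFSet.{u} → ZFSet.{u}) (ha : a ∈ j A) :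
    evalMap j A f a ∈ j (imageOn A f) :=
  (hj.mem_of_pair_mem_map_graphOn (hj.pair_evalMap_mem f ha)).2

/-- Łoś's theorem for an absolute relation. -/
theorem mem_map_sep_iff (hj : IsElementaryMap M j) (P : ZFSet.{u} → ZFSet.{u} → ZFSet.{u} → Prop)
    [hP : ∀ i k l : ℕ, IsAbsolute fun v => P (v i) (v k) (v l)] (f g h : ZFSet.{u} → ZFSet.{u})
    (ha : a ∈ j A) : a ∈ j (A.sep fun x => P (f x) (g x) (h x)) ↔
      P (evalMap j A f a) (evalMap j A g a) (evalMap j A h a) := by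
  have key := (hj.transfer₈ (fun A B C D F G H X => ∀ x ∈ A, ∀ r ∈ B, ∀ s ∈ C, ∀ t ∈ D,
    ZFSet.pair x r ∈ F → ZFSet.pair x s ∈ G → ZFSet.pair x t ∈ H → (x ∈ X ↔ P r s t))
    A (imageOn A f) (imageOn A g) (imageOn A h) (graphOn A f) (graphOn A g) (graphOn A h)
    (A.sep fun x => P (f x) (g x) (h x))).1 (by
    intro x hx r _ s _ t _ hr hs ht
    obtain rfl := (pair_mem_graphOn.1 hr).2
    obtain rfl := (pair_mem_graphOn.1 hs).2
    obtain rfl := (pair_mem_graphOn.1 ht).2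
    exact ZFSet.mem_sep.trans (and_iff_right hx))
  exact key a ha _ (hj.evalMap_mem_imageOn f ha) _ (hj.evalMap_mem_imageOn g ha) _
    (hj.evalMap_mem_imageOn h ha) (hj.pair_evalMap_mem f ha) (hj.pair_evalMap_mem g ha)
    (hj.pair_evalMap_mem h ha)

theorem evalMap_const (hj : IsElementaryMap M j) (c : ZFSet.{u}) (ha : a ∈ j A) :
    evalMap j A (fun _ => c) a = j c :=
  hj.evalMap_eq ((hj.transfer₃ (fun A G c => ∀ x ∈ A, ZFSet.pair x c ∈ G) A
    (graphOn A fun _ => c) c).1 (fun _ hx => pair_mem_graphOn.2 ⟨hx, rfl⟩) a ha)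

theorem evalMap_id (hj : IsElementaryMap M j) (ha : a ∈ j A) : evalMap j A (fun x => x) a = a :=
  hj.evalMap_eq ((hj.transfer₂ (fun A G => ∀ x ∈ A, ZFSet.pair x x ∈ G) A
    (graphOn A fun x => x)).1 (fun _ hx => pair_mem_graphOn.2 ⟨hx, rfl⟩) a ha)

/-- A value at a is also a value at (a, b). With `evalMap_snd` this brings two elements of the
ultrapower to a common seed. -/
theorem evalMap_fst (hj : IsElementaryMap M j) (f : ZFSet.{u} → ZFSet.{u}) (ha : a ∈ j A)
    (hab : ZFSet.pair a b ∈ j A) (hb : b ∈ j A) :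
    evalMap j A (fun x => f (fst x)) (ZFSet.pair a b) = evalMap j A f a := by
  have := (hj.transfer₄ (fun A B G G' => ∀ p ∈ A, ∀ x ∈ A, ∀ y ∈ A, ∀ r ∈ B, p = ZFSet.pair x y →
      ZFSet.pair x r ∈ G → ZFSet.pair p r ∈ G') A (imageOn A f) (graphOn A f)
      (graphOn A fun x => f (fst x))).1 fun p hp x _ y _ r _ hxy hr => by
    subst hxy
    exact pair_mem_graphOn.2 ⟨hp, by rw [fst_pair, (pair_mem_graphOn.1 hr).2]⟩
  exact hj.evalMap_eq (this _ hab a ha b hb _ (hj.evalMap_mem_imageOn f ha) rfl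
    (hj.pair_evalMap_mem f ha))

theorem evalMap_snd (hj : IsElementaryMap M j) (f : ZFSet.{u} → ZFSet.{u}) (ha : a ∈ j A)
    (hab : ZFSet.pair a b ∈ j A) (hb : b ∈ j A) :
    evalMap j A (fun x => f (snd x)) (ZFSet.pair a b) = evalMap j A f b := by
  have := (hj.transfer₄ (fun A B G G' => ∀ p ∈ A, ∀ x ∈ A, ∀ y ∈ A, ∀ r ∈ B, p = ZFSet.pair x y →
      ZFSet.pair y r ∈ G → ZFSet.pair p r ∈ G') A (imageOn A f) (graphOn A f)
      (graphOn A fun x => f (snd x))).1 fun p hp x _ y _ r _ hxy hr => by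
    subst hxy
    exact pair_mem_graphOn.2 ⟨hp, by rw [snd_pair, (pair_mem_graphOn.1 hr).2]⟩
  exact hj.evalMap_eq (this _ hab a ha b hb _ (hj.evalMap_mem_imageOn f hb) rfl
    (hj.pair_evalMap_mem f hb))

theorem pair_mem_map_sep_fst (hj : IsElementaryMap M j) (P : ZFSet.{u} → Prop) (ha : a ∈ j A)
    (hab : ZFSet.pair a b ∈ j A) (hb : b ∈ j A) :
    ZFSet.pair a b ∈ j (A.sep fun z => P (fst z)) ↔ a ∈ j (A.sep P) :=
  (hj.transfer₃ (fun A X Y => ∀ p ∈ A, ∀ x ∈ A, ∀ y ∈ A, p = ZFSet.pair x y → (p ∈ X ↔ x ∈ Y))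
    A (A.sep fun z => P (fst z)) (A.sep P)).1 (by
    rintro _ hp x hx y - rfl
    simp [hp, hx]) _ hab a ha b hb rfl

theorem mem_map_sep_imp (hj : IsElementaryMap M j) (P Q : ZFSet.{u} → Prop) (ha : a ∈ j A) :
    a ∈ j (A.sep fun x => P x → Q x) ↔ (a ∈ j (A.sep P) → a ∈ j (A.sep Q)) :=
  (hj.transfer₄ (fun A X Y Z => ∀ x ∈ A, (x ∈ X ↔ (x ∈ Y → x ∈ Z))) A
    (A.sep fun x => P x → Q x) (A.sep P) (A.sep Q)).1 (by
    intro x hx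
    simp [hx]) a ha

theorem mem_map_sep_const (hj : IsElementaryMap M j) (p : Prop) (ha : a ∈ j A) :
    a ∈ j (A.sep fun _ => p) ↔ p := by
  by_cases hp : p
  · have : (A.sep fun _ => p) = A := by ext; simp [hp]
    rw [this]
    exact iff_of_true ha hp
  · have : (A.sep fun _ => p) = ∅ := by ext; simp [hp]
    rw [this, hj.map_empty]
    exact iff_of_false (ZFSet.notMem_empty a) hp

theorem mem_map_sep_mono (hj : IsElementaryMap M j) {P Q : ZFSet.{u} → Prop}
    (h : ∀ x ∈ A, P x → Q x) (ha : a ∈ j (A.sep P)) : a ∈ j (A.sep Q) :=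
  hj.subset_iff.2 (fun x hx => by
    rw [ZFSet.mem_sep] at hx ⊢
    exact ⟨hx.1, h x hx.1 hx.2⟩) ha

end IsElementaryMap

/-- The transitive collapse of the class `X`. -/
noncomputable def collapse (X : Set ZFSet.{u}) (x : ZFSet.{u}) : ZFSet.{u} :=
  ZFSet.range fun y : {y // y ∈ x.sep fun y => y ∈ X} => collapse X y.1
termination_by x
decreasing_by exact (ZFSet.mem_sep.1 y.2).1

theorem mem_collapse {X : Set ZFSet.{u}} {x z : ZFSet.{u}} :
    z ∈ collapse X x ↔ ∃ y ∈ x, y ∈ X ∧ collapse X y = z := by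
  rw [collapse]
  simp [and_assoc]

theorem collapse_injOn {X : Set ZFSet.{u}}
    (hX : ∀ x ∈ X, ∀ y ∈ X, (∀ z ∈ X, z ∈ x ↔ z ∈ y) → x = y) {x y : ZFSet.{u}} (hx : x ∈ X)
    (hy : y ∈ X) (h : collapse X x = collapse X y) : x = y := by
  induction x using ZFSet.inductionOn generalizing y with
  | h x ih =>
    refine hX x hx y hy fun z hz => ⟨fun hzx => ?_, fun hzy => ?_⟩
    · have h1 : collapse X z ∈ collapse X y := h ▸ mem_collapse.2 ⟨z, hzx, hz, rfl⟩
      obtain ⟨w, hw, hwX, hwz⟩ := mem_collapse.1 h1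
      rwa [ih z hzx hz hwX hwz.symm]
    · have h1 : collapse X z ∈ collapse X x := h ▸ mem_collapse.2 ⟨z, hzy, hz, rfl⟩
      obtain ⟨w, hw, hwX, hwz⟩ := mem_collapse.1 h1
      rwa [← ih w hw hwX hz hwz]

theorem collapse_mem_collapse_iff {X : Set ZFSet.{u}}
    (hX : ∀ x ∈ X, ∀ y ∈ X, (∀ z ∈ X, z ∈ x ↔ z ∈ y) → x = y) {x y : ZFSet.{u}} (hx : x ∈ X) :
    collapse X x ∈ collapse X y ↔ x ∈ y := by
  rw [mem_collapse]
  constructor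
  · rintro ⟨z, hz, hzX, h⟩
    rwa [← collapse_injOn hX hzX hx h]
  · exact fun h => ⟨x, h, hx, rfl⟩

variable {κ : Cardinal.{u}} {θ : Ordinal.{u}}

/-- The representative `(a, f ↾ V_κ)`. -/
def rep {a : ZFSet.{u}} (ha : a ∈ V_ θ) (f : ZFSet.{u} → ZFSet.{u}) : UltRep κ θ :=
  (⟨a, ha⟩, fun x => f x)

theorem exists_rep (p : UltRep κ θ) : ∃ (a : ZFSet.{u}) (ha : a ∈ V_ θ) (f : ZFSet.{u} → ZFSet.{u}),
    p = rep ha f := by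
  classical
  refine ⟨p.1.1, p.1.2, fun x => if hx : x ∈ V_ κ.ord then p.2 ⟨x, hx⟩ else ∅, ?_⟩
  refine Prod.ext rfl (funext fun x => ?_)
  simp [rep]

theorem ultRel_rep {a b E : ZFSet.{u}} (ha : a ∈ V_ θ) (hb : b ∈ V_ θ)
    (f g : ZFSet.{u} → ZFSet.{u}) (R : ZFSet.{u} → ZFSet.{u} → Prop) :
    UltRel E R (rep ha f : UltRep κ θ) (rep hb g) ↔ ZFSet.pair (ZFSet.pair a b)
      ((V_ κ.ord).sep fun z => ∃ x ∈ V_ κ.ord, ∃ y ∈ V_ κ.ord, z = ZFSet.pair x y ∧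
        R (f x) (g y)) ∈ E := by
  have : ((V_ κ.ord).sep fun z => ∃ x y : {x : ZFSet.{u} // x ∈ V_ κ.ord},
      z = ZFSet.pair x.1 y.1 ∧ R (f x) (g y)) = ((V_ κ.ord).sep fun z => ∃ x ∈ V_ κ.ord,
      ∃ y ∈ V_ κ.ord, z = ZFSet.pair x y ∧ R (f x) (g y)) := by
    ext z
    simp only [ZFSet.mem_sep, Subtype.exists, exists_and_left, exists_prop]
    grind
  rw [← this]
  rfl

theorem pair_mem_derivedExtender (e : StrongnessEmbedding κ θ) {a X : ZFSet.{u}} :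
    ZFSet.pair a X ∈ derivedExtender e ↔ a ∈ V_ θ ∧ X ⊆ V_ κ.ord ∧ a ∈ e.map X := by
  rw [derivedExtender, ZFSet.mem_sep, ZFSet.pair_mem_prod, ZFSet.mem_powerset, and_assoc]
  refine and_congr_right fun _ => and_congr_right fun _ => ⟨?_, fun h => ⟨a, X, rfl, h⟩⟩
  rintro ⟨a', X', h, h'⟩
  obtain ⟨rfl, rfl⟩ := ZFSet.pair_inj.1 h
  exact h'

namespace StrongnessEmbedding

variable (e : StrongnessEmbedding κ θ)

/-- The value `j(f ↾ V_κ)(a)`. -/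
noncomputable def eval (f : ZFSet.{u} → ZFSet.{u}) (a : ZFSet.{u}) : ZFSet.{u} :=
  evalMap e.map (V_ κ.ord) f a

open Classical in
/-- The element of the target model of `j` that corresponds to a representative of an element of
the ultrapower by the derived extender. -/
noncomputable def factor (p : UltRep κ θ) : ZFSet.{u} :=
  e.eval (fun x => if hx : x ∈ V_ κ.ord then p.2 ⟨x, hx⟩ else ∅) p.1.1

theorem factor_rep {a : ZFSet.{u}} (ha : a ∈ V_ θ) (f : ZFSet.{u} → ZFSet.{u}) :
    e.factor (rep ha f) = e.eval f a := by
  unfold factor eval evalMap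
  rw [graphOn_congr (g := f)]
  · rfl
  · intro x hx
    simp [rep, hx]

section Ultrapower

variable {e}
variable {a b : ZFSet.{u}} {f g : ZFSet.{u} → ZFSet.{u}}

/-- The ultrapower embeds into the target model by [a, f] ↦ j(f)(a). The limit θ puts (a, b) into
V_θ, and θ < j(κ) puts a, b and (a, b) into the domain j(V_κ). -/
theorem ultRel_derivedExtender (hlim : Order.IsSuccLimit θ)
    (hθ : θ.toZFSet ∈ e.map κ.ord.toZFSet) (R : ZFSet.{u} → ZFSet.{u} → Prop)
    [∀ i k : ℕ, IsAbsolute fun v => R (v i) (v k)] (p q : UltRep κ θ) :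
    UltRel (derivedExtender e) R p q ↔ R (e.factor p) (e.factor q) := by
  obtain ⟨a, ha, f, rfl⟩ := exists_rep p
  obtain ⟨b, hb, g, rfl⟩ := exists_rep q
  have hj := e.isElementaryMap_map
  have hab := (pair_mem_vonNeumann hlim).2 ⟨ha, hb⟩
  rw [ultRel_rep, pair_mem_derivedExtender, and_iff_right hab, and_iff_right ZFSet.sep_subset,
    factor_rep, factor_rep]
  have hA : ∀ {x}, x ∈ V_ θ → x ∈ e.map (V_ κ.ord) := fun h => e.mem_map_vonNeumann hθ h
  refine (hj.transfer₆ (fun A B C G H Z => ∀ p ∈ A, ∀ x ∈ A, ∀ y ∈ A, ∀ r ∈ B, ∀ s ∈ C,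
    p = ZFSet.pair x y → ZFSet.pair x r ∈ G → ZFSet.pair y s ∈ H → (p ∈ Z ↔ R r s)) (V_ κ.ord)
    (imageOn (V_ κ.ord) f) (imageOn (V_ κ.ord) g) (graphOn (V_ κ.ord) f) (graphOn (V_ κ.ord) g)
    _).1 ?_ _ (hA hab) a (hA ha) b (hA hb) _ (hj.evalMap_mem_imageOn f (hA ha)) _
    (hj.evalMap_mem_imageOn g (hA hb)) rfl (hj.pair_evalMap_mem f (hA ha))
    (hj.pair_evalMap_mem g (hA hb))
  rintro _ hp x hx y hy r - s - rfl hr hs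
  obtain rfl := (pair_mem_graphOn.1 hr).2
  obtain rfl := (pair_mem_graphOn.1 hs).2
  rw [ZFSet.mem_sep, and_iff_right hp]
  constructor
  · rintro ⟨x', -, y', -, h, hR⟩
    obtain ⟨rfl, rfl⟩ := ZFSet.pair_inj.1 h
    exact hR
  · exact fun hR => ⟨x, hx, y, hy, rfl, hR⟩

theorem range_factor_extensional (hlim : Order.IsSuccLimit θ)
    (hθ : θ.toZFSet ∈ e.map κ.ord.toZFSet) : ∀ x ∈ Set.range e.factor, ∀ y ∈ Set.range e.factor,
      (∀ z ∈ Set.range e.factor, z ∈ x ↔ z ∈ y) → x = y := by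
  rintro _ ⟨p, rfl⟩ _ ⟨q, rfl⟩ h
  obtain ⟨a, ha, f, rfl⟩ := exists_rep p
  obtain ⟨b, hb, g, rfl⟩ := exists_rep q
  have hj := e.isElementaryMap_map
  have hA : ∀ {x}, x ∈ V_ θ → x ∈ e.map (V_ κ.ord) := fun h => e.mem_map_vonNeumann hθ h
  have hab := (pair_mem_vonNeumann hlim).2 ⟨ha, hb⟩
  -- The function w chooses an element of the symmetric difference whenever the two values differ,
  -- so j(w)(a, b) would separate distinct members of the range from within the range.
  have hw : ∀ x, ∃ y, f (fst x) = g (snd x) ∨ ¬ (y ∈ f (fst x) ↔ y ∈ g (snd x)) := by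
    intro x
    by_cases hx : f (fst x) = g (snd x)
    · exact ⟨∅, Or.inl hx⟩
    · by_contra! hcon
      exact hx (ZFSet.ext fun y => (hcon y).2)
  choose w hw using hw
  have key := (hj.mem_map_sep_iff (fun r s t => s = t ∨ ¬ (r ∈ s ↔ r ∈ t)) w (fun x => f (fst x))
    (fun x => g (snd x)) (hA hab)).1 (hj.mem_map_sep_mono (P := fun _ => True)
      (fun x _ _ => hw x) ((hj.mem_map_sep_const _ (hA hab)).2 trivial))
  rw [hj.evalMap_fst f (hA ha) (hA hab) (hA hb), hj.evalMap_snd g (hA ha) (hA hab) (hA hb)] at key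
  rw [factor_rep, factor_rep] at h ⊢
  exact key.resolve_right (not_not.2 (h _ ⟨rep hab w, factor_rep e hab w⟩))

/-- The ultrapower by a derived extender has a transitive collapse. -/
theorem exists_isUltrapowerCollapse (hlim : Order.IsSuccLimit θ)
    (hθ : θ.toZFSet ∈ e.map κ.ord.toZFSet) : ∃ (N : Set ZFSet.{u}) (π : UltRep κ θ → ZFSet.{u}),
      IsUltrapowerCollapse (derivedExtender e) N π := by
  have hX := range_factor_extensional hlim hθ
  refine ⟨_, fun p => collapse (Set.range e.factor) (e.factor p), ?_, rfl, ?_, ?_⟩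
  · rintro _ ⟨p, rfl⟩ y hy
    obtain ⟨_, -, ⟨q, rfl⟩, rfl⟩ := mem_collapse.1 hy
    exact ⟨q, rfl⟩
  · intro p q
    rw [ultRel_derivedExtender hlim hθ]
    exact ⟨collapse_injOn hX ⟨p, rfl⟩ ⟨q, rfl⟩, fun h => by rw [h]⟩
  · intro p q
    rw [ultRel_derivedExtender hlim hθ]
    exact collapse_mem_collapse_iff hX ⟨p, rfl⟩

end Ultrapower

end StrongnessEmbedding
end StrongLaver

/-! ### Łoś's theorem for all formulas and the ultrapower embedding -/

namespace StrongLaver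

open FirstOrder FirstOrder.Language

variable {κ : Cardinal.{u}} {θ : Ordinal.{u}}

theorem empty_mem_vonNeumann (hlim : Order.IsSuccLimit θ) : (∅ : ZFSet.{u}) ∈ V_ θ := by
  rw [ZFSet.mem_vonNeumann, ZFSet.rank_empty]
  exact hlim.bot_lt

/-- The embedding of `V` into the transitive collapse of an ultrapower. -/
def ultrapowerMap (hlim : Order.IsSuccLimit θ) (π : UltRep κ θ → ZFSet.{u}) (x : ZFSet.{u}) :
    ZFSet.{u} :=
  π (rep (empty_mem_vonNeumann hlim) fun _ => x)

namespace IsUltrapowerCollapse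

variable {e : StrongnessEmbedding κ θ} {N : Set ZFSet.{u}} {π : UltRep κ θ → ZFSet.{u}}

theorem mem (hc : IsUltrapowerCollapse (derivedExtender e) N π) (p : UltRep κ θ) : π p ∈ N :=
  hc.range_eq ▸ ⟨p, rfl⟩

theorem exists_rep (hc : IsUltrapowerCollapse (derivedExtender e) N π) {x : ZFSet.{u}}
    (hx : x ∈ N) : ∃ (a : ZFSet.{u}) (ha : a ∈ V_ θ) (f : ZFSet.{u} → ZFSet.{u}),
      x = π (rep ha f) := by
  rw [← hc.range_eq] at hx
  obtain ⟨p, rfl⟩ := hx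
  obtain ⟨a, ha, f, rfl⟩ := StrongLaver.exists_rep p
  exact ⟨a, ha, f, rfl⟩

theorem rep_eq_iff (hc : IsUltrapowerCollapse (derivedExtender e) N π)
    (hlim : Order.IsSuccLimit θ) (hθ : θ.toZFSet ∈ e.map κ.ord.toZFSet) {a b : ZFSet.{u}}
    (ha : a ∈ V_ θ) (hb : b ∈ V_ θ) (f g : ZFSet.{u} → ZFSet.{u}) :
    π (rep ha f) = π (rep hb g) ↔ e.eval f a = e.eval g b := by
  rw [hc.eq_iff, StrongnessEmbedding.ultRel_derivedExtender hlim hθ, e.factor_rep, e.factor_rep]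

theorem rep_mem_iff (hc : IsUltrapowerCollapse (derivedExtender e) N π)
    (hlim : Order.IsSuccLimit θ) (hθ : θ.toZFSet ∈ e.map κ.ord.toZFSet) {a b : ZFSet.{u}}
    (ha : a ∈ V_ θ) (hb : b ∈ V_ θ) (f g : ZFSet.{u} → ZFSet.{u}) :
    π (rep ha f) ∈ π (rep hb g) ↔ e.eval f a ∈ e.eval g b := by
  rw [hc.mem_iff, StrongnessEmbedding.ultRel_derivedExtender hlim hθ, e.factor_rep, e.factor_rep]

/-- Łoś's theorem for the ultrapower by a derived extender. -/
theorem realize_iff (hc : IsUltrapowerCollapse (derivedExtender e) N π)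
    (hlim : Order.IsSuccLimit θ) (hθ : θ.toZFSet ∈ e.map κ.ord.toZFSet) {α : Type} {n : ℕ}
    (φ : setLanguage.BoundedFormula α n) : ∀ {a : ZFSet.{u}} (ha : a ∈ V_ θ)
    (H : α → ZFSet.{u} → ZFSet.{u}) (G : Fin n → ZFSet.{u} → ZFSet.{u}),
    φ.Realize (fun i => (⟨π (rep ha (H i)), hc.mem _⟩ : N))
      (fun i => (⟨π (rep ha (G i)), hc.mem _⟩ : N)) ↔
      a ∈ e.map ((V_ κ.ord).sep fun x => φ.Realize (fun i => H i x) (fun i => G i x)) := by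
  have hj := e.isElementaryMap_map
  have hA : ∀ {x}, x ∈ V_ θ → x ∈ e.map (V_ κ.ord) := fun h => e.mem_map_vonNeumann hθ h
  have hvar : ∀ {n} (t : setLanguage.Term (α ⊕ Fin n)), ∃ i, t = Term.var i := by
    intro n t
    cases t with
    | var i => exact ⟨i, rfl⟩
    | func f => exact nomatch f
  have hN : ∀ {n : ℕ} {a : ZFSet.{u}} (ha : a ∈ V_ θ) (H : α → ZFSet.{u} → ZFSet.{u})
      (G : Fin n → ZFSet.{u} → ZFSet.{u}) (i : α ⊕ Fin n),
      Sum.elim (fun i => (⟨π (rep ha (H i)), hc.mem _⟩ : N))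
        (fun i => (⟨π (rep ha (G i)), hc.mem _⟩ : N)) i =
        ⟨π (rep ha (Sum.elim H G i)), hc.mem _⟩ := by
    rintro n a ha H G (i | i) <;> rfl
  have hV : ∀ {n : ℕ} (x : ZFSet.{u}) (H : α → ZFSet.{u} → ZFSet.{u})
      (G : Fin n → ZFSet.{u} → ZFSet.{u}) (i : α ⊕ Fin n),
      Sum.elim (fun i => H i x) (fun i => G i x) i = Sum.elim H G i x := by
    rintro n x H G (i | i) <;> rfl
  induction φ with
  | falsum => exact fun ha H G => (hj.mem_map_sep_const False (hA ha)).symm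
  | equal t s =>
    intro a ha H G
    obtain ⟨i, rfl⟩ := hvar t
    obtain ⟨k, rfl⟩ := hvar s
    simp only [BoundedFormula.Realize, Term.realize_var, hN, hV, Subtype.mk.injEq]
    rw [hc.rep_eq_iff hlim hθ]
    exact (hj.mem_map_sep_iff (fun x y _ => x = y) _ _ (fun _ => ∅) (hA ha)).symm
  | rel R ts =>
    intro a ha H G
    cases R
    obtain ⟨i, hi⟩ := hvar (ts 0)
    obtain ⟨k, hk⟩ := hvar (ts 1)
    change ((((ts 0).realize _ : N) : ZFSet.{u}) ∈ (((ts 1).realize _ : N) : ZFSet.{u})) ↔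
      a ∈ e.map ((V_ κ.ord).sep fun x => ((ts 0).realize _ : ZFSet.{u}) ∈
        ((ts 1).realize _ : ZFSet.{u}))
    rw [hi, hk]
    simp only [Term.realize_var, hN, hV]
    rw [hc.rep_mem_iff hlim hθ]
    exact (hj.mem_map_sep_iff (fun x y _ => x ∈ y) _ _ (fun _ => ∅) (hA ha)).symm
  | imp φ ψ ih₁ ih₂ =>
    intro a ha H G
    simp only [BoundedFormula.realize_imp]
    rw [ih₁ ha H G, ih₂ ha H G, hj.mem_map_sep_imp _ _ (hA ha)]
  | @all n φ ih =>
    intro a ha H G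
    simp only [BoundedFormula.realize_all]
    -- The induction hypothesis needs one common seed, so everything is moved to the seed (a, b).
    have step : ∀ {b : ZFSet.{u}} (hb : b ∈ V_ θ) (g : ZFSet.{u} → ZFSet.{u}),
        φ.Realize (fun i => (⟨π (rep ha (H i)), hc.mem _⟩ : N))
          (Fin.snoc (fun i => (⟨π (rep ha (G i)), hc.mem _⟩ : N)) ⟨π (rep hb g), hc.mem _⟩) ↔
        ZFSet.pair a b ∈ e.map ((V_ κ.ord).sep fun z => φ.Realize (fun i => H i (fst z))
          (Fin.snoc (fun i => G i (fst z)) (g (snd z)))) := by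
      intro b hb g
      have hab := (pair_mem_vonNeumann hlim).2 ⟨ha, hb⟩
      have h1 : ∀ f : ZFSet.{u} → ZFSet.{u},
          π (rep hab fun x => f (fst x)) = π (rep ha f) := fun f => by
        rw [hc.rep_eq_iff hlim hθ]
        exact hj.evalMap_fst f (hA ha) (hA hab) (hA hb)
      have h2 : π (rep hab fun x => g (snd x)) = π (rep hb g) := by
        rw [hc.rep_eq_iff hlim hθ]
        exact hj.evalMap_snd g (hA ha) (hA hab) (hA hb)
      have h3 := ih hab (fun i x => H i (fst x))
        (Fin.snoc (α := fun _ => ZFSet.{u} → ZFSet.{u}) (fun i x => G i (fst x)) fun x => g (snd x))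
      have h4 : (fun i => (⟨π (rep hab (Fin.snoc (α := fun _ => ZFSet.{u} → ZFSet.{u})
          (fun i x => G i (fst x)) (fun x => g (snd x)) i)), hc.mem _⟩ : N)) =
          Fin.snoc (α := fun _ => N) (fun i => (⟨π (rep ha (G i)), hc.mem _⟩ : N))
            ⟨π (rep hb g), hc.mem _⟩ := by
        funext i
        refine Fin.lastCases ?_ (fun i => ?_) i
        · simp [h2]
        · simp [h1]
      have h5 : ∀ z, (fun i => Fin.snoc (α := fun _ => ZFSet.{u} → ZFSet.{u})
          (fun i x => G i (fst x)) (fun x => g (snd x)) i z) =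
          Fin.snoc (α := fun _ => ZFSet.{u}) (fun i => G i (fst z)) (g (snd z)) := by
        intro z
        funext i
        refine Fin.lastCases ?_ (fun i => ?_) i <;> simp
      simp only [h1] at h3
      rw [h4] at h3
      simp only [h5] at h3
      exact h3
    constructor
    · intro h
      by_contra hcon
      -- The function w chooses a counterexample wherever there is one, so the instance at [a, w]
      -- already implies the universal statement.
      have hw : ∀ x, ∃ y, φ.Realize (fun i => H i x) (Fin.snoc (fun i => G i x) y) →
          ∀ y, φ.Realize (fun i => H i x) (Fin.snoc (fun i => G i x) y) := by
        intro x
        by_cases hx : ∀ y, φ.Realize (fun i => H i x) (Fin.snoc (fun i => G i x) y)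
        · exact ⟨∅, fun _ => hx⟩
        · push Not at hx
          obtain ⟨y, hy⟩ := hx
          exact ⟨y, fun h => absurd h hy⟩
      choose w hw using hw
      have h2 := ih ha H (Fin.snoc (α := fun _ => ZFSet.{u} → ZFSet.{u}) G w)
      have h4 : (fun i => (⟨π (rep ha (Fin.snoc (α := fun _ => ZFSet.{u} → ZFSet.{u})
          G w i)), hc.mem _⟩ : N)) =
          Fin.snoc (α := fun _ => N) (fun i => (⟨π (rep ha (G i)), hc.mem _⟩ : N))
            ⟨π (rep ha w), hc.mem _⟩ := by
        funext i
        refine Fin.lastCases ?_ (fun i => ?_) i <;> simp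
      have h5 : ∀ z, (fun i => Fin.snoc (α := fun _ => ZFSet.{u} → ZFSet.{u}) G w i z) =
          Fin.snoc (α := fun _ => ZFSet.{u}) (fun i => G i z) (w z) := by
        intro z
        funext i
        refine Fin.lastCases ?_ (fun i => ?_) i <;> simp
      rw [h4] at h2
      simp only [h5] at h2
      exact hcon (hj.mem_map_sep_mono (fun x _ hx => hw x hx) (h2.1 (h ⟨_, hc.mem _⟩)))
    · rintro h ⟨y, hy⟩
      obtain ⟨b, hb, g, rfl⟩ := hc.exists_rep hy
      have hab := (pair_mem_vonNeumann hlim).2 ⟨ha, hb⟩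
      rw [step hb g]
      rw [← hj.pair_mem_map_sep_fst _ (hA ha) (hA hab) (hA hb)] at h
      exact hj.mem_map_sep_mono (fun x _ hx => hx _) h

theorem isElementaryMap (hc : IsUltrapowerCollapse (derivedExtender e) N π)
    (hlim : Order.IsSuccLimit θ) (hθ : θ.toZFSet ∈ e.map κ.ord.toZFSet) :
    IsElementaryMap N (ultrapowerMap hlim π) := by
  refine ⟨hc.transitive, ⟨fun x => ⟨ultrapowerMap hlim π x, hc.mem _⟩, fun n φ x => ?_⟩,
    fun _ => rfl⟩
  have h0 := empty_mem_vonNeumann hlim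
  have h := hc.realize_iff hlim hθ φ h0 (fun i _ => x i) (fun i _ => i.elim0)
  have hj := e.isElementaryMap_map
  rw [hj.mem_map_sep_const _ (e.mem_map_vonNeumann hθ h0)] at h
  rw [Formula.Realize, Formula.Realize]
  convert h using 2
  rfl

/-- The collapse is the identity on `V_θ`. -/
theorem rep_id (hc : IsUltrapowerCollapse (derivedExtender e) N π)
    (hlim : Order.IsSuccLimit θ) (hθ : θ.toZFSet ∈ e.map κ.ord.toZFSet) {a : ZFSet.{u}}
    (ha : a ∈ V_ θ) : π (rep ha fun x => x) = a := by
  have hj := e.isElementaryMap_map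
  have hid : ∀ {x}, x ∈ V_ θ → e.eval (fun x => x) x = x := fun h =>
    hj.evalMap_id (e.mem_map_vonNeumann hθ h)
  induction a using ZFSet.inductionOn with
  | h a ih =>
    have htr := ZFSet.isTransitive_vonNeumann θ a ha
    ext z
    constructor
    · intro hz
      obtain ⟨b, hb, g, rfl⟩ := hc.exists_rep (hc.transitive _ (hc.mem _) z hz)
      rw [hc.rep_mem_iff hlim hθ, hid ha] at hz
      rw [(hc.rep_eq_iff hlim hθ hb (htr hz) g (fun x => x)).2 (hid (htr hz)).symm, ih _ hz]
      exact hz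
    · intro hz
      rw [← ih z hz (htr hz), hc.rep_mem_iff hlim hθ, hid ha, hid (htr hz)]
      exact hz

/-- Because the collapse fixes V_θ pointwise, the ultrapower embedding agrees with j on V_θ; in
particular guesses in V_θ made by j survive. -/
theorem mem_ultrapowerMap_iff (hc : IsUltrapowerCollapse (derivedExtender e) N π)
    (hlim : Order.IsSuccLimit θ) (hθ : θ.toZFSet ∈ e.map κ.ord.toZFSet) {a : ZFSet.{u}}
    (ha : a ∈ V_ θ) (X : ZFSet.{u}) : a ∈ ultrapowerMap hlim π X ↔ a ∈ e.map X := by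
  have hj := e.isElementaryMap_map
  have h := hc.rep_mem_iff hlim hθ ha (empty_mem_vonNeumann hlim) (fun x => x) fun _ => X
  rw [hc.rep_id hlim hθ ha] at h
  refine h.trans ?_
  rw [StrongnessEmbedding.eval, StrongnessEmbedding.eval,
    hj.evalMap_id (e.mem_map_vonNeumann hθ ha),
    hj.evalMap_const X (e.mem_map_vonNeumann hθ (empty_mem_vonNeumann hlim))]

theorem vonNeumann_subset (hc : IsUltrapowerCollapse (derivedExtender e) N π)
    (hlim : Order.IsSuccLimit θ) (hθ : θ.toZFSet ∈ e.map κ.ord.toZFSet) :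
    V_ θ ⊆ ultrapowerMap hlim π (V_ κ.ord) := fun _ ha =>
  (hc.mem_ultrapowerMap_iff hlim hθ ha _).2 (e.mem_map_vonNeumann hθ ha)

end IsUltrapowerCollapse
end StrongLaver

/-! ### Well-founded relations in the ultrapower -/

namespace StrongLaver

open FirstOrder FirstOrder.Language

variable {κ : Cardinal.{u}} {θ : Ordinal.{u}}

namespace IsUltrapowerCollapse

variable {e : StrongnessEmbedding κ θ} {N : Set ZFSet.{u}} {π : UltRep κ θ → ZFSet.{u}}

/-- Łoś's theorem for absolute predicates. -/
theorem absolute_iff (hc : IsUltrapowerCollapse (derivedExtender e) N π)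
    (hlim : Order.IsSuccLimit θ) (hθ : θ.toZFSet ∈ e.map κ.ord.toZFSet)
    (P : (ℕ → ZFSet.{u}) → Prop) [hP : IsAbsolute P] {a : ZFSet.{u}} (ha : a ∈ V_ θ)
    (H : ℕ → ZFSet.{u} → ZFSet.{u}) :
    P (fun i => π (rep ha (H i))) ↔ a ∈ e.map ((V_ κ.ord).sep fun x => P fun i => H i x) := by
  obtain ⟨φ, hφ⟩ := hP
  have h := hc.realize_iff hlim hθ φ ha H (fun i _ => i.elim0)
  have h1 := hφ N _ hc.transitive.isTransitiveModel fun i => ⟨π (rep ha (H i)), hc.mem _⟩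
  have h2 := fun x => hφ _ _ isTransitiveModel_id fun i => H i x
  rw [← h1, Formula.Realize, Subsingleton.elim default
    (fun i : Fin 0 => (⟨π (rep ha (fun _ => i.elim0)), hc.mem _⟩ : N)), h]
  refine iff_of_eq (congrArg (fun X => a ∈ e.map X) ?_)
  ext x
  rw [ZFSet.mem_sep, ZFSet.mem_sep, ← h2 x, Formula.Realize]
  exact and_congr_right fun _ => iff_of_eq (congrArg _ (Subsingleton.elim _ _))

/-- Łoś's theorem for an absolute relation with two parameters. -/
theorem ultRel_iff (hc : IsUltrapowerCollapse (derivedExtender e) N π)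
    (hlim : Order.IsSuccLimit θ) (hθ : θ.toZFSet ∈ e.map κ.ord.toZFSet)
    (P : ZFSet.{u} → ZFSet.{u} → ZFSet.{u} → ZFSet.{u} → Prop)
    [hP : IsAbsolute fun v => P (v 0) (v 1) (v 2) (v 3)] (c d : ZFSet.{u}) (p q : UltRep κ θ) :
    UltRel (derivedExtender e) (P c d) p q ↔
      P (ultrapowerMap hlim π c) (ultrapowerMap hlim π d) (π p) (π q) := by
  obtain ⟨a, ha, f, rfl⟩ := StrongLaver.exists_rep p
  obtain ⟨b, hb, g, rfl⟩ := StrongLaver.exists_rep q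
  have hj := e.isElementaryMap_map
  have hA : ∀ {x}, x ∈ V_ θ → x ∈ e.map (V_ κ.ord) := fun h => e.mem_map_vonNeumann hθ h
  have hab := (pair_mem_vonNeumann hlim).2 ⟨ha, hb⟩
  rw [ultRel_rep, pair_mem_derivedExtender, and_iff_right hab, and_iff_right ZFSet.sep_subset]
  have h1 : π (rep hab fun x => f (fst x)) = π (rep ha f) := by
    rw [hc.rep_eq_iff hlim hθ]
    exact hj.evalMap_fst f (hA ha) (hA hab) (hA hb)
  have h2 : π (rep hab fun x => g (snd x)) = π (rep hb g) := by
    rw [hc.rep_eq_iff hlim hθ]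
    exact hj.evalMap_snd g (hA ha) (hA hab) (hA hb)
  have h3 : ∀ c, π (rep hab fun _ => c) = ultrapowerMap hlim π c := fun c => by
    rw [ultrapowerMap, hc.rep_eq_iff hlim hθ, StrongnessEmbedding.eval, StrongnessEmbedding.eval,
      hj.evalMap_const c (hA hab), hj.evalMap_const c (hA (empty_mem_vonNeumann hlim))]
  have h4 := hc.absolute_iff hlim hθ (fun v => P (v 0) (v 1) (v 2) (v 3)) hab
    (fun n => [fun _ => c, fun _ => d, fun x => f (fst x), fun x => g (snd x)].getD n id)
  refine Iff.trans ?_ (h4.symm.trans ?_)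
  · refine (hj.transfer₃ (fun A X Y => ∀ p ∈ A, ∀ x ∈ A, ∀ y ∈ A, p = ZFSet.pair x y →
      (p ∈ X ↔ p ∈ Y)) (V_ κ.ord) _ _).1 ?_ _ (hA hab) a (hA ha) b (hA hb) rfl
    rintro _ hp x hx y hy rfl
    rw [ZFSet.mem_sep, ZFSet.mem_sep]
    refine and_congr_right fun _ => ?_
    constructor
    · rintro ⟨x', -, y', -, h, hR⟩
      obtain ⟨rfl, rfl⟩ := ZFSet.pair_inj.1 h
      simpa using hR
    · exact fun hR => ⟨x, hx, y, hy, rfl, by simpa using hR⟩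
  · change P (π (rep hab fun _ => c)) (π (rep hab fun _ => d)) (π (rep hab fun x => f (fst x)))
      (π (rep hab fun x => g (snd x))) ↔ _
    rw [h1, h2, h3, h3]

end IsUltrapowerCollapse

/-- The set of pairs `R` is a well-founded relation. -/
def IsWFRel (R : ZFSet.{u}) : Prop := WellFounded fun x y => ZFSet.pair x y ∈ R

/-- The set of all well-founded relations on `V_κ`. -/
noncomputable def wfRels (κ : Cardinal.{u}) : ZFSet.{u} :=
  (V_ κ.ord).powerset.sep IsWFRel

/-- The disjoint union of all relations on `A` that are in `W`. -/
def Prec (W A x y : ZFSet.{u}) : Prop :=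
  ∃ R ∈ W, ∃ s ∈ A, ∃ t ∈ A, x = ZFSet.pair R s ∧ y = ZFSet.pair R t ∧ ZFSet.pair s t ∈ R

instance (i k l m : ℕ) : IsAbsolute.{u} fun v => Prec (v i) (v k) (v l) (v m) := by
  unfold Prec
  infer_instance

theorem Prec.mem_prod {W A x y : ZFSet.{u}} (h : Prec W A x y) : x ∈ W.prod A ∧ y ∈ W.prod A := by
  obtain ⟨R, hR, s, hs, t, ht, rfl, rfl, -⟩ := h
  exact ⟨ZFSet.pair_mem_prod.2 ⟨hR, hs⟩, ZFSet.pair_mem_prod.2 ⟨hR, ht⟩⟩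

theorem wellFounded_prec (A : ZFSet.{u}) : WellFounded (Prec (wfRels κ) A) := by
  have key : ∀ R, IsWFRel R → ∀ t, Acc (Prec (wfRels κ) A) (ZFSet.pair R t) := by
    intro R hR t
    induction t using hR.induction with
    | _ t ih =>
      refine Acc.intro _ ?_
      rintro x ⟨R', -, s, -, t', -, rfl, h, hst⟩
      obtain ⟨rfl, rfl⟩ := ZFSet.pair_inj.1 h
      exact ih s hst
  refine ⟨fun y => Acc.intro _ ?_⟩
  rintro x ⟨R, hR, s, -, t, -, rfl, -, -⟩
  exact key R (ZFSet.mem_sep.1 hR).2 s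

/-- A well-founded relation on a set maps to the membership relation. -/
theorem exists_map_mem {r : ZFSet.{u} → ZFSet.{u} → Prop} (hr : WellFounded r) (D : ZFSet.{u})
    (hD : ∀ x y, r x y → x ∈ D) : ∃ f : ZFSet.{u} → ZFSet.{u}, ∀ x y, r x y → f x ∈ f y := by
  let F : ∀ y, (∀ x, r x y → ZFSet.{u}) → ZFSet.{u} := fun y ih =>
    ZFSet.range fun x : {x // x ∈ D.sep fun x => r x y} => ih x.1 (ZFSet.mem_sep.1 x.2).2
  refine ⟨hr.fix F, fun x y h => ?_⟩
  rw [hr.fix_eq F y]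
  exact ZFSet.mem_range.2 ⟨⟨x, ZFSet.mem_sep.2 ⟨hD x y h, h⟩⟩, rfl⟩

/-- A map ρ from `Prec` to ∈, composed with representatives, sends the induced relation to true
membership in the target model of j. -/
theorem wellFounded_ultRel_prec (hlim : Order.IsSuccLimit θ) {E : ZFSet.{u}}
    (hE : IsExtender κ θ E) :
    WellFounded (UltRel E (Prec (wfRels κ) (V_ κ.ord)) : UltRep κ θ → UltRep κ θ → Prop) := by
  obtain ⟨e, hθ, rfl⟩ := hE
  obtain ⟨ρ, hρ⟩ := exists_map_mem (wellFounded_prec (κ := κ) (V_ κ.ord)) _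
    fun x y h => h.mem_prod.1
  refine Subrelation.wf (r := InvImage (· ∈ ·) fun p : UltRep κ θ =>
    e.factor (p.1, fun x => ρ (p.2 x))) ?_ (InvImage.wf _ ZFSet.mem_wf)
  intro p q h
  rw [InvImage, ← StrongnessEmbedding.ultRel_derivedExtender hlim hθ (fun x y => x ∈ y)]
  unfold UltRel at h ⊢
  rw [pair_mem_derivedExtender] at h ⊢
  refine ⟨h.1, ZFSet.sep_subset, e.isElementaryMap_map.subset_iff.2 (fun z hz => ?_) h.2.2⟩
  rw [ZFSet.mem_sep] at hz ⊢
  obtain ⟨hz, x, y, rfl, hxy⟩ := hz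
  exact ⟨hz, x, y, rfl, hρ _ _ hxy⟩

end StrongLaver

/-! ### Codes for the induced relation and well-foundedness of the Mitchell order -/

namespace StrongLaver

variable {κ : Cardinal.{u}} {θ : Ordinal.{u}}

theorem powerset_mem_vonNeumann (hlim : Order.IsSuccLimit θ) {x : ZFSet.{u}} (hx : x ∈ V_ θ) :
    x.powerset ∈ V_ θ := by
  rw [ZFSet.mem_vonNeumann] at hx ⊢
  rw [ZFSet.rank_powerset]
  exact hlim.succ_lt hx

theorem union_mem_vonNeumann {x y : ZFSet.{u}} (hx : x ∈ V_ θ) (hy : y ∈ V_ θ) :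
    x ∪ y ∈ V_ θ := by
  rw [ZFSet.mem_vonNeumann] at hx hy ⊢
  rw [ZFSet.rank_union]
  exact max_lt hx hy

theorem prod_mem_vonNeumann (hlim : Order.IsSuccLimit θ) {x y : ZFSet.{u}} (hx : x ∈ V_ θ)
    (hy : y ∈ V_ θ) : x.prod y ∈ V_ θ :=
  ZFSet.mem_vonNeumann_of_subset (y := (x ∪ y).powerset.powerset)
    (by unfold ZFSet.prod ZFSet.pairSep; exact ZFSet.sep_subset) (powerset_mem_vonNeumann hlim (powerset_mem_vonNeumann hlim (union_mem_vonNeumann hx hy)))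

theorem graphOn_subset_prod {A B : ZFSet.{u}} {f : ZFSet.{u} → ZFSet.{u}}
    (h : ∀ x ∈ A, f x ∈ B) : graphOn A f ⊆ A.prod B := by
  intro z hz
  obtain ⟨x, hx, rfl⟩ := mem_graphOn.1 hz
  exact ZFSet.pair_mem_prod.2 ⟨hx, h x hx⟩

/-- The value of the set function `h` at `x`. -/
noncomputable def app (h x : ZFSet.{u}) : ZFSet.{u} :=
  Classical.epsilon fun y => ZFSet.pair x y ∈ h

theorem app_graphOn {A x : ZFSet.{u}} (f : ZFSet.{u} → ZFSet.{u}) (hx : x ∈ A) :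
    app (graphOn A f) x = f x :=
  (pair_mem_graphOn.1 (Classical.epsilon_spec (p := fun y => ZFSet.pair x y ∈ graphOn A f)
    ⟨f x, pair_mem_graphOn.2 ⟨hx, rfl⟩⟩)).2.symm

variable (κ) in
/-- The set of all pairs of a well-founded relation on `V_κ` and an element of `V_κ`. -/
noncomputable def precField : ZFSet.{u} := (wfRels κ).prod (V_ κ.ord)

variable (κ) in
/-- A set that contains all functions from `V_κ` to `precField κ ∪ {∅}`. -/
noncomputable def precFuns : ZFSet.{u} :=
  ((V_ κ.ord).prod (precField κ ∪ {∅})).powerset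

variable (κ) in
/-- The set of all pairs `(x, y)` with `h' x` below `h y`. -/
noncomputable def precSet (h' h : ZFSet.{u}) : ZFSet.{u} :=
  (V_ κ.ord).sep fun z => ∃ x ∈ V_ κ.ord, ∃ y ∈ V_ κ.ord, z = ZFSet.pair x y ∧
    Prec (wfRels κ) (V_ κ.ord) (app h' x) (app h y)

variable (κ) in
/-- The map `(h', h) ↦ precSet κ h' h`, as a set. -/
noncomputable def precTable : ZFSet.{u} :=
  graphOn ((precFuns κ).prod (precFuns κ)) fun z => precSet κ (fst z) (snd z)

theorem precFuns_mem (hlim : Order.IsSuccLimit θ) (hlt : κ.ord < θ) : precFuns κ ∈ V_ θ := by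
  have hV := ZFSet.vonNeumann_mem_of_lt hlt
  have hW : wfRels κ ∈ V_ θ :=
    ZFSet.mem_vonNeumann_of_subset ZFSet.sep_subset (powerset_mem_vonNeumann hlim hV)
  have h1 : ({∅} : ZFSet.{u}) ∈ V_ θ := by
    refine ZFSet.mem_vonNeumann_of_subset (y := (∅ : ZFSet.{u}).powerset) ?_
      (powerset_mem_vonNeumann hlim (empty_mem_vonNeumann hlim))
    intro x hx
    rw [ZFSet.mem_singleton.1 hx, ZFSet.mem_powerset]
  exact powerset_mem_vonNeumann hlim (prod_mem_vonNeumann hlim hV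
    (union_mem_vonNeumann (prod_mem_vonNeumann hlim hW hV) h1))

/-- Being in V_θ, the table can be a parameter inside any ultrapower; with it the induced relation
becomes Δ₀ in the extender. -/
theorem precTable_mem (hlim : Order.IsSuccLimit θ) (hlt : κ.ord < θ) : precTable κ ∈ V_ θ := by
  have hF := precFuns_mem hlim hlt
  refine ZFSet.mem_vonNeumann_of_subset (graphOn_subset_prod (B := (V_ κ.ord).powerset) ?_)
    (prod_mem_vonNeumann hlim (prod_mem_vonNeumann hlim hF hF)
      (powerset_mem_vonNeumann hlim (ZFSet.vonNeumann_mem_of_lt hlt)))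
  intro x _
  rw [ZFSet.mem_powerset]
  exact ZFSet.sep_subset

open Classical in
/-- The function `f`, cut off outside `precField κ`, as a set. -/
noncomputable def precCode (κ : Cardinal.{u}) (f : ZFSet.{u} → ZFSet.{u}) : ZFSet.{u} :=
  graphOn (V_ κ.ord) fun x => if f x ∈ precField κ then f x else ∅

theorem precCode_mem (f : ZFSet.{u} → ZFSet.{u}) : precCode κ f ∈ precFuns κ := by
  rw [precFuns, ZFSet.mem_powerset]
  refine graphOn_subset_prod fun x _ => ?_
  rw [ZFSet.mem_union, ZFSet.mem_singleton]
  split_ifs with h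
  exacts [Or.inl h, Or.inr rfl]

theorem empty_notMem_precField : (∅ : ZFSet.{u}) ∉ precField κ := by
  intro h
  obtain ⟨a, -, b, -, h⟩ := ZFSet.mem_prod.1 h
  exact ZFSet.notMem_empty {a} (h ▸ ZFSet.mem_pair.2 (Or.inl rfl))

theorem pair_ne_empty (a b : ZFSet.{u}) : ZFSet.pair a b ≠ ∅ := fun h =>
  ZFSet.notMem_empty {a} (h ▸ ZFSet.mem_pair.2 (Or.inl rfl))

/-- The cut-off is harmless: `Prec` relates only elements of `precField κ`, and ∅ is not one of
them. -/
theorem precSet_precCode (f g : ZFSet.{u} → ZFSet.{u}) :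
    precSet κ (precCode κ f) (precCode κ g) = (V_ κ.ord).sep fun z => ∃ x ∈ V_ κ.ord,
      ∃ y ∈ V_ κ.ord, z = ZFSet.pair x y ∧ Prec (wfRels κ) (V_ κ.ord) (f x) (g y) := by
  classical
  ext z
  rw [precSet, ZFSet.mem_sep, ZFSet.mem_sep]
  refine and_congr_right fun _ => exists_congr fun x => and_congr_right fun hx =>
    exists_congr fun y => and_congr_right fun hy => and_congr_right fun _ => ?_
  rw [precCode, precCode, app_graphOn _ hx, app_graphOn _ hy]
  constructor
  · intro h
    have h1 := h.mem_prod
    split_ifs at h h1 with hf hg hg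
    · exact h
    · exact absurd h1.2 empty_notMem_precField
    · exact absurd h1.1 empty_notMem_precField
    · exact absurd h1.1 empty_notMem_precField
  · intro h
    rwa [if_pos (c := f x ∈ precField κ) h.mem_prod.1, if_pos (c := g y ∈ precField κ) h.mem_prod.2]

/-- The relation `UltRel E Prec` on codes of representatives, with an additional top `∅`;
all quantifiers are bounded by `A`, and `q` stands for `precTable`. -/
def CodeRel (A E q n' n : ZFSet.{u}) : Prop :=
  (n = ∅ ∧ ¬ n' = ∅) ∨ ∃ a' ∈ A, ∃ h' ∈ A, ∃ a ∈ A, ∃ h ∈ A, ∃ T ∈ A, ∃ s ∈ A, ∃ t ∈ A,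
    n' = ZFSet.pair a' h' ∧ n = ZFSet.pair a h ∧ s = ZFSet.pair h' h ∧ ZFSet.pair s T ∈ q ∧
      t = ZFSet.pair a' a ∧ ZFSet.pair t T ∈ E

instance (i k l m n : ℕ) : IsAbsolute.{u} fun v => CodeRel (v i) (v k) (v l) (v m) (v n) := by
  unfold CodeRel
  infer_instance

theorem codeRel_elim {A n' n : ZFSet.{u}} {e : StrongnessEmbedding κ θ}
    (hlim : Order.IsSuccLimit θ)
    (h : CodeRel A (derivedExtender e) (precTable κ) n' n) :
    (n = ∅ ∧ n' ≠ ∅) ∨ ∃ (a' a h' h : ZFSet.{u}) (ha' : a' ∈ V_ θ) (ha : a ∈ V_ θ),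
      n' = ZFSet.pair a' h' ∧ n = ZFSet.pair a h ∧ UltRel (derivedExtender e)
        (Prec (wfRels κ) (V_ κ.ord)) (rep ha' (app h') : UltRep κ θ) (rep ha (app h)) := by
  refine h.imp id ?_
  rintro ⟨a', -, h', -, a, -, g, -, T, -, _, -, _, -, rfl, rfl, rfl, hT, rfl, hE⟩
  obtain ⟨ha', ha⟩ := (pair_mem_vonNeumann hlim).1 (pair_mem_derivedExtender e |>.1 hE).1
  refine ⟨a', a, h', g, ha', ha, rfl, rfl, ?_⟩
  rw [ultRel_rep]
  obtain ⟨-, rfl⟩ := pair_mem_graphOn.1 hT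
  rw [fst_pair, snd_pair] at hE
  exact hE

theorem codeRel_intro {A a b : ZFSet.{u}} {e : StrongnessEmbedding κ θ}
    (hlim : Order.IsSuccLimit θ) (hlt : κ.ord < θ) (hA : V_ θ ⊆ A) (ha : a ∈ V_ θ) (hb : b ∈ V_ θ)
    {f g : ZFSet.{u} → ZFSet.{u}}
    (h : UltRel (derivedExtender e) (Prec (wfRels κ) (V_ κ.ord)) (rep ha f : UltRep κ θ)
      (rep hb g)) :
    CodeRel A (derivedExtender e) (precTable κ) (ZFSet.pair a (precCode κ f))
      (ZFSet.pair b (precCode κ g)) := by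
  have hF : ∀ f, precCode κ f ∈ V_ θ := fun f =>
    ZFSet.isTransitive_vonNeumann θ _ (precFuns_mem hlim hlt) (precCode_mem f)
  rw [ultRel_rep, ← precSet_precCode] at h
  refine Or.inr ⟨a, hA ha, _, hA (hF f), b, hA hb, _, hA (hF g), precSet κ (precCode κ f)
    (precCode κ g), hA ?_, _, hA ((pair_mem_vonNeumann hlim).2 ⟨hF f, hF g⟩), _,
    hA ((pair_mem_vonNeumann hlim).2 ⟨ha, hb⟩), rfl, rfl, rfl, ?_, rfl, h⟩
  · exact ZFSet.mem_vonNeumann_of_subset ZFSet.sep_subset (ZFSet.vonNeumann_mem_of_lt hlt)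
  · refine pair_mem_graphOn.2 ⟨ZFSet.pair_mem_prod.2 ⟨precCode_mem f, precCode_mem g⟩, ?_⟩
    rw [fst_pair, snd_pair]

/-- Codes inherit accessibility from the representatives that they decode to. Predecessors of a
nonempty set are such codes, and the top ∅ has only nonempty predecessors. -/
theorem wellFounded_codeRel {A : ZFSet.{u}} {e : StrongnessEmbedding κ θ}
    (hlim : Order.IsSuccLimit θ) (hθ : θ.toZFSet ∈ e.map κ.ord.toZFSet) :
    WellFounded (CodeRel A (derivedExtender e) (precTable κ)) := by
  have hwf := wellFounded_ultRel_prec hlim (E := derivedExtender e) ⟨e, hθ, rfl⟩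
  have h1 : ∀ p : UltRep κ θ, ∀ (a h : ZFSet.{u}) (ha : a ∈ V_ θ), p = rep ha (app h) →
      Acc (CodeRel A (derivedExtender e) (precTable κ)) (ZFSet.pair a h) := by
    intro p
    induction p using hwf.induction with
    | _ p ih =>
      rintro a h ha rfl
      refine Acc.intro _ fun n' hn => ?_
      rcases codeRel_elim hlim hn with ⟨h0, -⟩ | ⟨a', b, h', g, ha', hb, rfl, hp, hU⟩
      · exact absurd h0 (pair_ne_empty a h)
      · obtain ⟨rfl, rfl⟩ := ZFSet.pair_inj.1 hp
        exact ih _ hU a' h' ha' rfl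
  have h2 : ∀ n, n ≠ ∅ → Acc (CodeRel A (derivedExtender e) (precTable κ)) n := by
    intro n hn
    refine Acc.intro _ fun n' h => ?_
    rcases codeRel_elim hlim h with ⟨h0, -⟩ | ⟨a', b, h', g, ha', hb, rfl, -, -⟩
    · exact absurd h0 hn
    · exact h1 _ a' h' ha' rfl
  refine ⟨fun n => ?_⟩
  by_cases hn : n = ∅
  · subst hn
    refine Acc.intro _ fun n' h => h2 n' ?_
    rcases codeRel_elim hlim h with ⟨-, h0⟩ | ⟨a', b, h', g, -, -, -, hp, -⟩
    · exact h0
    · exact absurd hp.symm (pair_ne_empty b g)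
  · exact h2 n hn

/-- An elementary embedding maps the set of well-founded relations to a set that contains all
well-founded relations of the target model. -/
theorem IsElementaryMap.mem_map_wfRels {M : Set ZFSet.{u}} {j : ZFSet.{u} → ZFSet.{u}}
    (hj : IsElementaryMap M j) (hκ : Order.IsSuccLimit κ.ord) {R : ZFSet.{u}}
    (hR : R ∈ j (V_ κ.ord).powerset) (hwf : IsWFRel R) : R ∈ j (wfRels κ) := by
  -- Well-foundedness is not Δ₀, but its failure on V_κ is witnessed by a subset D of V_κ without
  -- minimal element, so this dichotomy is bounded by P = P(V_κ).
  have key := (hj.transfer₂ (fun P W => ∀ R ∈ P, R ∈ W ∨ ∃ D ∈ P, (∃ x ∈ D, x = x) ∧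
    ∀ x ∈ D, ∃ y ∈ D, ZFSet.pair y x ∈ R) (V_ κ.ord).powerset (wfRels κ)).1 (by
    intro R hR
    by_cases h : IsWFRel R
    · exact Or.inl (ZFSet.mem_sep.2 ⟨hR, h⟩)
    · right
      rw [IsWFRel, WellFounded.wellFounded_iff_has_min] at h
      push Not at h
      obtain ⟨s, ⟨x, hx⟩, hs⟩ := h
      have hsV : ∀ x ∈ s, x ∈ V_ κ.ord := fun x hx => by
        obtain ⟨y, -, hyx⟩ := hs x hx
        exact ((pair_mem_vonNeumann hκ).1 (ZFSet.mem_powerset.1 hR hyx)).2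
      refine ⟨(V_ κ.ord).sep fun x => x ∈ s, ZFSet.mem_powerset.2 ZFSet.sep_subset,
        ⟨x, ZFSet.mem_sep.2 ⟨hsV x hx, hx⟩, rfl⟩, fun x hx => ?_⟩
      obtain ⟨y, hy, hyx⟩ := hs x (ZFSet.mem_sep.1 hx).2
      exact ⟨y, ZFSet.mem_sep.2 ⟨hsV y hy, hy⟩, hyx⟩)
  rcases key R hR with h | ⟨D, -, ⟨x, hx, -⟩, hD⟩
  · exact h
  · obtain ⟨m, hm, hmin⟩ := hwf.has_min {x | x ∈ D} ⟨x, hx⟩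
    obtain ⟨y, hy, hym⟩ := hD m hm
    exact absurd hym (hmin y hy)

/-- If `E` is in the ultrapower by `F` then that ultrapower has a relation that extends the
relation of `E` by a new top. -/
theorem exists_embedding_of_mem (hlim : Order.IsSuccLimit θ) (hlt : κ.ord < θ)
    {e e' : StrongnessEmbedding κ θ} (hθ : θ.toZFSet ∈ e.map κ.ord.toZFSet)
    (hθ' : θ.toZFSet ∈ e'.map κ.ord.toZFSet) {N : Set ZFSet.{u}} {π : UltRep κ θ → ZFSet.{u}}
    (hc : IsUltrapowerCollapse (derivedExtender e) N π) (hE : derivedExtender e' ∈ N) :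
    ∃ (Φ : UltRep κ θ → UltRep κ θ) (t : UltRep κ θ),
      (∀ p q, UltRel (derivedExtender e') (Prec (wfRels κ) (V_ κ.ord)) p q →
        UltRel (derivedExtender e) (Prec (wfRels κ) (V_ κ.ord)) (Φ p) (Φ q)) ∧
      ∀ p, UltRel (derivedExtender e) (Prec (wfRels κ) (V_ κ.ord)) (Φ p) t := by
  have hj := hc.isElementaryMap hlim hθ
  have hκ := e.isSuccLimit_ord
  have hVθ := hc.vonNeumann_subset hlim hθ
  -- The extender is only known to be an element of N, so the quantifier over E must be unbounded.
  obtain ⟨R, hR, hRw⟩ := (hj.transfer_forall (fun E v => ∀ q, q ∈ v 0 → ∃ R, R ∈ v 1 ∧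
      ∀ w, w ∈ v 0 → (w ∈ R ↔ ∃ n', n' ∈ v 0 ∧ ∃ n, n ∈ v 0 ∧ w = ZFSet.pair n' n ∧
        CodeRel (v 0) E q n' n)) fun n => [V_ κ.ord, (V_ κ.ord).powerset].getD n ∅).1
    (fun E q _ => ⟨(V_ κ.ord).sep fun w => ∃ n', n' ∈ V_ κ.ord ∧ ∃ n, n ∈ V_ κ.ord ∧
      w = ZFSet.pair n' n ∧ CodeRel (V_ κ.ord) E q n' n, ZFSet.mem_powerset.2 ZFSet.sep_subset,
      fun w hw => ZFSet.mem_sep.trans (and_iff_right hw)⟩) _ hE (precTable κ)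
    (hVθ (precTable_mem hlim hlt))
  change R ∈ ultrapowerMap hlim π (V_ κ.ord).powerset at hR
  change ∀ w ∈ ultrapowerMap hlim π (V_ κ.ord), (w ∈ R ↔ ∃ n' ∈ ultrapowerMap hlim π (V_ κ.ord),
    ∃ n ∈ ultrapowerMap hlim π (V_ κ.ord), w = ZFSet.pair n' n ∧
      CodeRel (ultrapowerMap hlim π (V_ κ.ord)) (derivedExtender e') (precTable κ) n' n) at hRw
  have hRV : R ⊆ ultrapowerMap hlim π (V_ κ.ord) :=
    (hj.transfer₂ (fun P V => ∀ R ∈ P, R ⊆ V) (V_ κ.ord).powerset (V_ κ.ord)).1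
      (fun R h => ZFSet.mem_powerset.1 h) R hR
  have hwf : IsWFRel R := by
    refine Subrelation.wf (r := CodeRel (ultrapowerMap hlim π (V_ κ.ord)) (derivedExtender e')
      (precTable κ)) ?_ (wellFounded_codeRel hlim hθ')
    intro x y hxy
    obtain ⟨n', -, n, -, hp, h⟩ := (hRw _ (hRV hxy)).1 hxy
    obtain ⟨rfl, rfl⟩ := ZFSet.pair_inj.1 hp
    exact h
  have hRW := hj.mem_map_wfRels hκ hR hwf
  have hmem : ∀ n' ∈ V_ θ, ∀ n ∈ V_ θ, CodeRel (ultrapowerMap hlim π (V_ κ.ord))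
      (derivedExtender e') (precTable κ) n' n → ZFSet.pair n' n ∈ R := fun n' hn' n hn h =>
    (hRw _ (hVθ ((pair_mem_vonNeumann hlim).2 ⟨hn', hn⟩))).2 ⟨n', hVθ hn', n, hVθ hn, rfl, h⟩
  have hVN : ∀ x ∈ V_ θ, x ∈ N := fun x hx => hc.transitive _ (hj.apply_mem (V_ κ.ord)) x (hVθ hx)
  have hRN : R ∈ N := hc.transitive _ (hj.apply_mem _) R hR
  have hex : ∀ x ∈ V_ θ, ∃ p : UltRep κ θ, π p = ZFSet.pair R x := fun x hx => by
    have := hj.pair_mem hRN (hVN x hx)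
    rwa [← hc.range_eq] at this
  have hcode : ∀ p : UltRep κ θ, ∃ n ∈ V_ θ, n ≠ ∅ ∧ ∃ (a : ZFSet.{u}) (ha : a ∈ V_ θ)
      (f : ZFSet.{u} → ZFSet.{u}), p = rep ha f ∧ n = ZFSet.pair a (precCode κ f) := fun p => by
    obtain ⟨a, ha, f, rfl⟩ := exists_rep p
    exact ⟨_, (pair_mem_vonNeumann hlim).2 ⟨ha, ZFSet.isTransitive_vonNeumann θ _
      (precFuns_mem hlim hlt) (precCode_mem f)⟩, pair_ne_empty _ _, a, ha, f, rfl, rfl⟩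
  choose n hn hn0 hcode using hcode
  choose ψ hψ using hex
  have h0 := empty_mem_vonNeumann hlim
  have hU : ∀ x (hx : x ∈ V_ θ) y (hy : y ∈ V_ θ), CodeRel (ultrapowerMap hlim π (V_ κ.ord))
      (derivedExtender e') (precTable κ) x y → UltRel (derivedExtender e)
      (Prec (wfRels κ) (V_ κ.ord)) (ψ x hx) (ψ y hy) := fun x hx y hy h => by
    rw [hc.ultRel_iff hlim hθ, hψ, hψ]
    exact ⟨R, hRW, x, hVθ hx, y, hVθ hy, rfl, rfl, hmem x hx y hy h⟩
  -- A representative p goes to one of (R, code of p), and the new top is (R, ∅).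
  refine ⟨fun p => ψ (n p) (hn p), ψ ∅ h0, fun p q h => hU _ _ _ _ ?_, fun p =>
    hU _ _ _ _ (Or.inl ⟨rfl, hn0 p⟩)⟩
  obtain ⟨a, ha, f, rfl, hnp⟩ := hcode p
  obtain ⟨b, hb, g, rfl, hnq⟩ := hcode q
  rw [hnp, hnq]
  exact codeRel_intro hlim hlt hVθ ha hb h

/-- The rank of the relation that an extender induces on the representatives of pairs in
`precField κ`. -/
noncomputable def extenderRank (hlim : Order.IsSuccLimit θ)
    (E : {E : ZFSet.{u} // IsExtender κ θ E}) : Ordinal.{u + 1} :=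
  ⨆ p, Order.succ ((wellFounded_ultRel_prec hlim E.2).apply p).rank

theorem rank_le_rank_of_map {α : Type u} {r s : α → α → Prop}
    (hr : WellFounded r) (hs : WellFounded s) (f : α → α) (h : ∀ a b, r a b → s (f a) (f b))
    (a : α) : (hr.apply a).rank ≤ (hs.apply (f a)).rank := by
  induction a using hr.induction with
  | _ a ih =>
    rw [Acc.rank_eq]
    refine Ordinal.iSup_le fun b => Order.succ_le_of_lt ?_
    exact (ih b.1 b.2).trans_lt (Acc.rank_lt_of_rel (hs.apply (f a)) (h _ _ b.2))

theorem extenderRank_lt (hlim : Order.IsSuccLimit θ) (hlt : κ.ord < θ)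
    {E F : {E : ZFSet.{u} // IsExtender κ θ E}} (h : MitchellOrder κ θ E F) :
    extenderRank hlim E < extenderRank hlim F := by
  obtain ⟨E, e', hθ', rfl⟩ := E
  obtain ⟨F, e, hθ, rfl⟩ := F
  obtain ⟨N, π, hc, hE⟩ := h
  obtain ⟨Φ, t, hΦ, ht⟩ := exists_embedding_of_mem hlim hlt hθ hθ' hc hE
  have hwE := wellFounded_ultRel_prec hlim (E := derivedExtender e') ⟨e', hθ', rfl⟩
  have hwF := wellFounded_ultRel_prec hlim (E := derivedExtender e) ⟨e, hθ, rfl⟩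
  have h1 : extenderRank hlim ⟨derivedExtender e', e', hθ', rfl⟩ ≤ (hwF.apply t).rank :=
    Ordinal.iSup_le fun p => Order.succ_le_of_lt
      ((rank_le_rank_of_map hwE hwF Φ hΦ p).trans_lt (Acc.rank_lt_of_rel (hwF.apply t) (ht p)))
  exact (h1.trans_lt (Order.lt_succ _)).trans_le
    (Ordinal.le_iSup (fun p => Order.succ (hwF.apply p).rank) t)

theorem wellFounded_mitchellOrder (hlim : Order.IsSuccLimit θ) (hlt : κ.ord < θ) :
    WellFounded (MitchellOrder κ θ) :=
  Subrelation.wf (r := InvImage (· < ·) (extenderRank hlim))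
    (fun h => extenderRank_lt hlim hlt h) (InvImage.wf _ Ordinal.lt_wf)

end StrongLaver

/-! ### The upper bound for the Mitchell rank -/

namespace StrongLaver

variable {κ : Cardinal.{u}} {θ : Ordinal.{u}}

theorem derivedExtender_subset (hlim : Order.IsSuccLimit θ) (hlt : κ.ord < θ)
    (e : StrongnessEmbedding κ θ) : derivedExtender e ⊆ V_ θ := by
  intro z hz
  obtain ⟨a, ha, X, hX, rfl⟩ := ZFSet.mem_prod.1 (ZFSet.mem_sep.1 hz).1
  exact (pair_mem_vonNeumann hlim).2 ⟨ha, ZFSet.mem_vonNeumann_of_subset (ZFSet.mem_powerset.1 hX)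
    (ZFSet.vonNeumann_mem_of_lt hlt)⟩

/-- An extender below `F` is determined by an element of `V_θ`. -/
theorem exists_code_of_mitchellOrder (hlim : Order.IsSuccLimit θ) (hlt : κ.ord < θ)
    {E F : {E : ZFSet.{u} // IsExtender κ θ E}} (h : MitchellOrder κ θ E F) :
    ∃ c ∈ V_ θ, E.1 = (V_ θ).sep fun z => ZFSet.pair (ZFSet.pair z (fst c)) (snd c) ∈ F.1 := by
  obtain ⟨E, e', hθ', rfl⟩ := E
  obtain ⟨F, e, hθ, rfl⟩ := F
  obtain ⟨N, π, hc, hE⟩ := h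
  obtain ⟨a, ha, f, hf⟩ := hc.exists_rep hE
  -- With E = [a, f] and z = [z, id] for z in V_θ, the statement z ∈ E is decided by the measure of
  -- F with index (z, a).
  refine ⟨ZFSet.pair a ((V_ κ.ord).sep fun z => ∃ x ∈ V_ κ.ord, ∃ y ∈ V_ κ.ord,
    z = ZFSet.pair x y ∧ x ∈ f y), (pair_mem_vonNeumann hlim).2 ⟨ha,
      ZFSet.mem_vonNeumann_of_subset ZFSet.sep_subset (ZFSet.vonNeumann_mem_of_lt hlt)⟩, ?_⟩
  rw [fst_pair, snd_pair]
  ext z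
  have key : ∀ hz : z ∈ V_ θ, z ∈ derivedExtender e' ↔ ZFSet.pair (ZFSet.pair z a)
      ((V_ κ.ord).sep fun z => ∃ x ∈ V_ κ.ord, ∃ y ∈ V_ κ.ord, z = ZFSet.pair x y ∧ x ∈ f y) ∈
      derivedExtender e := fun hz => by
    rw [← ultRel_rep hz ha (fun x => x) f (fun x y => x ∈ y), ← hc.mem_iff, hc.rep_id hlim hθ hz]
    exact iff_of_eq (congrArg (z ∈ ·) hf)
  rw [ZFSet.mem_sep]
  exact ⟨fun h => ⟨derivedExtender_subset hlim hlt e' h,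
    (key (derivedExtender_subset hlim hlt e' h)).1 h⟩, fun h => (key h.1).2 h.2⟩

theorem mk_mitchellOrder_le (hlim : Order.IsSuccLimit θ) (hlt : κ.ord < θ)
    (F : {E : ZFSet.{u} // IsExtender κ θ E}) :
    Cardinal.mk {E // MitchellOrder κ θ E F} ≤ Cardinal.lift.{u + 1} (V_ θ).card := by
  rw [← ZFSet.cardinalMk_coe_sort]
  choose c hc hE using fun E : {E // MitchellOrder κ θ E F} =>
    exists_code_of_mitchellOrder hlim hlt E.2
  refine Cardinal.mk_le_of_injective (f := fun E => ⟨c E, hc E⟩) fun E E' h => ?_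
  have h' : c E = c E' := congrArg Subtype.val h
  exact Subtype.ext (Subtype.ext (by rw [hE E, hE E', h']))

theorem lift_ord_succ (c : Cardinal.{u}) : Ordinal.lift.{u + 1} (Order.succ c).ord =
    (Order.succ (Cardinal.lift.{u + 1} c)).ord := by
  rw [Cardinal.lift_ord, Cardinal.lift_succ]

/-- By induction along the order: the rank of F is a supremum of at most ℶ_θ ordinals below the
regular cardinal ℶ_θ^+. -/
theorem rank_mitchellOrder_lt (hlim : Order.IsSuccLimit θ) (hlt : κ.ord < θ)
    [IsWellFounded _ (MitchellOrder κ θ)] (F : {E : ZFSet.{u} // IsExtender κ θ E}) :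
    IsWellFounded.rank (MitchellOrder κ θ) F <
      Ordinal.lift.{u + 1} (Order.succ (Cardinal.beth θ)).ord := by
  rw [lift_ord_succ]
  have h0 : Cardinal.aleph0 ≤ Cardinal.lift.{u + 1} (Cardinal.beth θ) := by
    rw [Cardinal.aleph0_le_lift]
    exact Cardinal.aleph0_le_beth θ
  have hreg := Cardinal.isRegular_succ h0
  have hcard : (V_ θ).card = Cardinal.beth θ := by
    obtain ⟨_, e, -, -⟩ := F
    exact e.card_vonNeumann_eq_beth hlt.le
  induction F using IsWellFounded.induction (MitchellOrder κ θ) with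
  | _ F ih =>
    rw [IsWellFounded.rank_eq]
    refine Ordinal.iSup_lt_of_lt_cof ?_ fun E => ?_
    · rw [hreg.cof_ord, Order.lt_succ_iff, ← hcard]
      exact mk_mitchellOrder_le hlim hlt F
    · exact (Cardinal.isSuccLimit_ord hreg.aleph0_le).succ_lt (ih E.1 E.2)

/-! ### Joint Laver sequences as one set -/

/-- A cofinal sequence of length `cof θ`. -/
theorem exists_cofinal_sequence (θ : Ordinal.{u}) : ∃ b : Ordinal.{u} → Ordinal.{u},
    (∀ a < θ.cof.ord, b a < θ) ∧ ∀ d < θ, ∃ a < θ.cof.ord, d ≤ b a := by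
  classical
  obtain ⟨s, hs, hcard⟩ := Order.exists_cof_eq θ.ToType
  rw [Ordinal.cof_toType] at hcard
  have hmk : Cardinal.mk θ.cof.ord.ToType = Cardinal.mk s := by rw [Cardinal.mk_ord_toType, hcard]
  obtain ⟨i⟩ := Cardinal.eq.1 hmk
  let g : Set.Iio θ.cof.ord → Set.Iio θ := fun a => (i (Ordinal.ToType.mk a) : θ.ToType).toOrd
  have hg : ∀ d : Set.Iio θ, ∃ a, d ≤ g a := fun d => by
    obtain ⟨x, hx, hdx⟩ := hs (Ordinal.ToType.mk d)
    refine ⟨(i.symm ⟨x, hx⟩).toOrd, (OrderIso.le_symm_apply Ordinal.ToType.mk).2 ?_⟩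
    rw [OrderIso.apply_symm_apply, Equiv.apply_symm_apply]
    exact hdx
  refine ⟨fun a => if h : a ∈ Set.Iio θ.cof.ord then g ⟨a, h⟩ else 0, fun a ha => ?_,
    fun d hd => ?_⟩
  · beta_reduce
    rw [dif_pos (Set.mem_Iio.2 ha)]
    exact (g _).2
  · obtain ⟨a, ha⟩ := hg ⟨d, hd⟩
    refine ⟨a, a.2, ?_⟩
    beta_reduce
    rw [dif_pos a.2]
    exact ha

/-- All pairs `((α, ζ), ℓ_α(ζ))` with `α < λ`. -/
noncomputable def jointGraph (κ : Cardinal.{u}) (lam : Ordinal.{u}) (ℓ : Ordinal.{u} → ZFSet.{u}) :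
    ZFSet.{u} :=
  (V_ κ.ord).sep fun w => ∃ a < lam, ∃ z y, w = ZFSet.pair (ZFSet.pair a.toZFSet z) y ∧
    ZFSet.pair z y ∈ ℓ a

theorem mem_jointGraph {lam a : Ordinal.{u}} {ℓ : Ordinal.{u} → ZFSet.{u}} {z y : ZFSet.{u}}
    (h : ZFSet.pair (ZFSet.pair a.toZFSet z) y ∈ jointGraph κ lam ℓ) :
    a < lam ∧ ZFSet.pair z y ∈ ℓ a := by
  obtain ⟨-, b, hb, z', y', h, h'⟩ := ZFSet.mem_sep.1 h
  obtain ⟨h1, rfl⟩ := ZFSet.pair_inj.1 h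
  obtain ⟨h2, rfl⟩ := ZFSet.pair_inj.1 h1
  obtain rfl := Ordinal.toZFSet_injective h2
  exact ⟨hb, h'⟩

theorem jointGraph_unique {lam : Ordinal.{u}} {ℓ : Ordinal.{u} → ZFSet.{u}} {p y y' : ZFSet.{u}}
    (hℓ : ∀ a < lam, ZFSet.IsFunc κ.ord.toZFSet (V_ κ.ord) (ℓ a))
    (h : ZFSet.pair p y ∈ jointGraph κ lam ℓ) (h' : ZFSet.pair p y' ∈ jointGraph κ lam ℓ) :
    y = y' := by
  obtain ⟨-, b, hb, z, _, h1, hy⟩ := ZFSet.mem_sep.1 h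
  obtain ⟨rfl, rfl⟩ := ZFSet.pair_inj.1 h1
  have hy' := (mem_jointGraph h').2
  have hz := (ZFSet.pair_mem_prod.1 ((hℓ b hb).1 hy)).1
  exact ((hℓ b hb).2 z hz).unique hy hy'

/-- Guesses of the single functions give guesses of the joint graph. -/
theorem pair_mem_map_jointGraph (e : StrongnessEmbedding κ θ) {lam : Ordinal.{u}}
    (hlam : lam ≤ κ.ord) {ℓ : Ordinal.{u} → ZFSet.{u}}
    (hℓ : ∀ a < lam, ZFSet.IsFunc κ.ord.toZFSet (V_ κ.ord) (ℓ a)) {a : Ordinal.{u}} (ha : a < lam)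
    {y : ZFSet.{u}} (h : Guesses e (ℓ a) y) :
    y ∈ e.map (V_ κ.ord) ∧
      ZFSet.pair (ZFSet.pair a.toZFSet κ.ord.toZFSet) y ∈ e.map (jointGraph κ lam ℓ) := by
  have hj := e.isElementaryMap_map
  have hκ := e.isSuccLimit_ord
  have h1 := (hj.transfer₅ (fun O V l a L => ∀ w ∈ l, ∃ z ∈ O, ∃ y ∈ V, w = ZFSet.pair z y ∧
    ∃ p ∈ V, p = ZFSet.pair a z ∧ ZFSet.pair p y ∈ L) κ.ord.toZFSet (V_ κ.ord) (ℓ a) a.toZFSet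
    (jointGraph κ lam ℓ)).1 (by
      intro w hw
      obtain ⟨z, hz, y, hy, rfl⟩ := ZFSet.mem_prod.1 ((hℓ a ha).1 hw)
      have hp : ZFSet.pair a.toZFSet z ∈ V_ κ.ord := (pair_mem_vonNeumann hκ).2
        ⟨toZFSet_mem_vonNeumann.2 (ha.trans_le hlam), Ordinal.toZFSet_subset_vonNeumann _ hz⟩
      exact ⟨z, hz, y, hy, rfl, _, hp, rfl, ZFSet.mem_sep.2
        ⟨(pair_mem_vonNeumann hκ).2 ⟨hp, hy⟩, a, ha, z, y, rfl, hw⟩⟩)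
  -- The index a < κ is not moved, so j(ℓ_a) appears in j of the joint graph at the same index a.
  rw [e.map_toZFSet (ha.trans_le hlam)] at h1
  obtain ⟨z, -, y', hy, h2, p, -, rfl, hp⟩ := h1 _ h
  obtain ⟨rfl, rfl⟩ := ZFSet.pair_inj.1 h2
  exact ⟨hy, hp⟩

/-- All values that are guessed at the same time are elements of one element of `j(V_κ)`. -/
theorem exists_mem_map_of_guesses (e : StrongnessEmbedding κ θ) {lam : Ordinal.{u}}
    (hlam : lam ≤ κ.ord) {ℓ : Ordinal.{u} → ZFSet.{u}}
    (hℓ : ∀ a < lam, ZFSet.IsFunc κ.ord.toZFSet (V_ κ.ord) (ℓ a)) {y : Ordinal.{u} → ZFSet.{u}}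
    (h : ∀ a < lam, Guesses e (ℓ a) (y a)) :
    ∃ t ∈ e.map (V_ κ.ord), ∀ a < lam, y a ∈ t := by
  have hj := e.isElementaryMap_map
  have hκ := e.isSuccLimit_ord
  -- For k, l < κ the values ℓ_a(k) with a < l have bounded rank in κ by `exists_bound`. The
  -- transferred statement is used at k = κ and l = lam, both below j(κ) even if lam = κ.
  have h1 := (hj.transfer₃ (fun O V L => ∀ k ∈ O, ∀ l ∈ O, ∃ t ∈ V, ∀ a ∈ l, ∀ y ∈ V,
    (∃ w ∈ L, ∃ p ∈ V, p = ZFSet.pair a k ∧ w = ZFSet.pair p y) → y ∈ t)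
    κ.ord.toZFSet (V_ κ.ord) (jointGraph κ lam ℓ)).1 (by
      intro k _ l hl
      set A := l.sep fun a => ∃ y, ZFSet.pair (ZFSet.pair a k) y ∈ jointGraph κ lam ℓ with hA
      have hAV : A ∈ V_ κ.ord := ZFSet.mem_vonNeumann_of_subset ZFSet.sep_subset
        (Ordinal.toZFSet_subset_vonNeumann _ hl)
      have hg : ∀ a ∈ A, ZFSet.pair (ZFSet.pair a k) (app (jointGraph κ lam ℓ) (ZFSet.pair a k)) ∈
          jointGraph κ lam ℓ := fun a ha => Classical.epsilon_spec
        (p := fun y => ZFSet.pair (ZFSet.pair a k) y ∈ jointGraph κ lam ℓ) (ZFSet.mem_sep.1 ha).2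
      obtain ⟨b, hb, hbA⟩ := e.exists_bound hAV
        (fun a => (app (jointGraph κ lam ℓ) (ZFSet.pair a k)).rank) fun a ha =>
          ZFSet.mem_vonNeumann.1 ((pair_mem_vonNeumann hκ).1 (ZFSet.mem_sep.1 (hg a ha)).1).2
      refine ⟨V_ b, ZFSet.vonNeumann_mem_of_lt hb, ?_⟩
      rintro a ha y _ ⟨_, hw, _, -, rfl, rfl⟩
      have haA : a ∈ A := ZFSet.mem_sep.2 ⟨ha, y, hw⟩
      rw [jointGraph_unique hℓ hw (hg a haA), ZFSet.mem_vonNeumann]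
      exact hbA a haA)
  have hl : lam.toZFSet ∈ e.map κ.ord.toZFSet := by
    rcases hlam.eq_or_lt with rfl | hl
    · exact e.crit_mem_map
    · exact (hj.isOrdinal_map _).mem_trans (Ordinal.toZFSet_mem_toZFSet_iff.2 hl) e.crit_mem_map
  obtain ⟨t, ht, h2⟩ := h1 _ e.crit_mem_map _ hl
  refine ⟨t, ht, fun a ha => ?_⟩
  obtain ⟨hy, hL⟩ := pair_mem_map_jointGraph e hlam hℓ ha (h a ha)
  have htr := hj.isTransitive_map (ZFSet.isTransitive_vonNeumann κ.ord)
  have hp : ZFSet.pair a.toZFSet κ.ord.toZFSet ∈ e.map (V_ κ.ord) := by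
    obtain ⟨p, hp, y', -, h3⟩ := (hj.transfer₂ (fun L V => ∀ w ∈ L, ∃ p ∈ V, ∃ y ∈ V,
      w = ZFSet.pair p y) (jointGraph κ lam ℓ) (V_ κ.ord)).1 (by
        intro w hw
        obtain ⟨hw, a, -, z, y, rfl, -⟩ := ZFSet.mem_sep.1 hw
        exact ⟨_, ((pair_mem_vonNeumann hκ).1 hw).1, _, ((pair_mem_vonNeumann hκ).1 hw).2, rfl⟩)
      _ hL
    rwa [(ZFSet.pair_inj.1 h3).1]
  exact h2 _ (Ordinal.toZFSet_mem_toZFSet_iff.2 ha) _ hy ⟨_, hL, _, hp, rfl, rfl⟩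

end StrongLaver

/-! ### The lower bound for the Mitchell rank -/

namespace StrongLaver

variable {κ : Cardinal.{u}} {θ : Ordinal.{u}}

/-- A joint Laver sequence of length `cof θ` gives an extender whose ultrapower contains all
sections of a given subset of `V_θ`. -/
theorem exists_extender_of_joint (hlim : Order.IsSuccLimit θ) (hcof : θ.cof ≤ κ)
    (hlt : κ.ord < θ) {ℓ : Ordinal.{u} → ZFSet.{u}}
    (hℓ : IsJointLaverSequence κ θ θ.cof.ord ℓ) {C : ZFSet.{u}} (hC : C ⊆ V_ θ)
    (hC0 : ∀ z ∈ V_ θ, ZFSet.pair ∅ z ∈ C) :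
    ∃ (F : {E : ZFSet.{u} // IsExtender κ θ E}) (N : Set ZFSet.{u}) (π : UltRep κ θ → ZFSet.{u}),
      IsUltrapowerCollapse F.1 N π ∧ ∀ x ∈ V_ θ, ((V_ θ).sep fun z => ZFSet.pair x z ∈ C) ∈ N := by
  obtain ⟨b, hbθ, hb⟩ := exists_cofinal_sequence θ
  have hlam : θ.cof.ord ≤ κ.ord := Cardinal.ord_le_ord.2 hcof
  have hfun : ∀ a < θ.cof.ord, ZFSet.IsFunc κ.ord.toZFSet (V_ κ.ord) (ℓ a) :=
    fun a ha => (hℓ.1 a ha).1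
  -- C may have rank θ, too large to be guessed at once; its pieces below the cofinal stages are
  -- elements of V_θ and exhaust it.
  set y : Ordinal.{u} → ZFSet.{u} := fun a => C.sep fun w => w ∈ V_ (b a) with hy
  have hyθ : ∀ a < θ.cof.ord, y a ∈ V_ θ := fun a ha =>
    ZFSet.mem_vonNeumann_of_subset (fun w hw => (ZFSet.mem_sep.1 hw).2)
      (ZFSet.vonNeumann_mem_of_lt (hbθ a ha))
  have hyC : ∀ w ∈ C, ∃ a < θ.cof.ord, w ∈ y a := fun w hw => by
    obtain ⟨a, ha, h⟩ := hb _ (hlim.succ_lt (ZFSet.mem_vonNeumann.1 (hC hw)))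
    exact ⟨a, ha, ZFSet.mem_sep.2 ⟨hw, ZFSet.mem_vonNeumann.2 (Order.succ_le_iff.1 h)⟩⟩
  obtain ⟨e, he⟩ := hℓ.2 y hyθ
  have hκ := e.isSuccLimit_ord
  -- The full section at ∅ makes the ranks in the pieces unbounded in θ. All pieces lie in one t ∈
  -- j(V_κ), so θ ≤ rank(t) < j(κ).
  have hθ : θ.toZFSet ∈ e.map κ.ord.toZFSet := by
    obtain ⟨t, ht, hyt⟩ := exists_mem_map_of_guesses e hlam hfun he
    rw [← ZFSet.IsOrdinal.rank_lt_iff_mem (ZFSet.isOrdinal_toZFSet θ)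
      (e.isElementaryMap_map.isOrdinal_map _), Ordinal.rank_toZFSet]
    refine lt_of_le_of_lt (le_of_forall_lt fun d hd => ?_)
      (e.isElementaryMap_map.rank_lt_of_mem_map_vonNeumann ht)
    obtain ⟨a, ha, hda⟩ := hyC _ (hC0 d.toZFSet (toZFSet_mem_vonNeumann.2 hd))
    have h1 : d < (ZFSet.pair ∅ d.toZFSet).rank := by
      simp [ZFSet.pair]
    exact h1.trans ((ZFSet.rank_lt_of_mem hda).trans (ZFSet.rank_lt_of_mem (hyt a ha)))
  obtain ⟨N, π, hc⟩ := StrongnessEmbedding.exists_isUltrapowerCollapse hlim hθ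
  refine ⟨⟨_, e, hθ, rfl⟩, N, π, hc, fun x hx => ?_⟩
  have hj := hc.isElementaryMap hlim hθ
  have hV := hc.vonNeumann_subset hlim hθ
  set j := ultrapowerMap hlim π with hjdef
  set L := jointGraph κ θ.cof.ord ℓ with hL
  have ho : ∀ a < θ, a.toZFSet ∈ V_ θ := fun a ha => toZFSet_mem_vonNeumann.2 ha
  have hk := ho _ hlt
  have hl := ho _ (hlam.trans_lt hlt)
  have hpθ : ∀ a < θ.cof.ord, ZFSet.pair a.toZFSet κ.ord.toZFSet ∈ V_ θ := fun a ha =>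
    (pair_mem_vonNeumann hlim).2 ⟨ho a (ha.trans (hlam.trans_lt hlt)), hk⟩
  have hyL : ∀ a < θ.cof.ord, ZFSet.pair (ZFSet.pair a.toZFSet κ.ord.toZFSet) (y a) ∈ j L :=
    fun a ha => (hc.mem_ultrapowerMap_iff hlim hθ
      ((pair_mem_vonNeumann hlim).2 ⟨hpθ a ha, hyθ a ha⟩) _).2
      (pair_mem_map_jointGraph e hlam hfun ha (he a ha)).2
  have hun := (hj.transfer₂ (fun V L => ∀ p ∈ V, ∀ y ∈ V, ∀ z ∈ V, ZFSet.pair p y ∈ L →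
    ZFSet.pair p z ∈ L → y = z) (V_ κ.ord) L).1
    fun p _ y _ z _ h1 h2 => jointGraph_unique hfun h1 h2
  -- N defines the section at x from j(L) and the parameters x, k = κ, l = cf(θ) in V_θ: it consists
  -- of the z with (x, z) in some piece j(L)(a, κ), a < cf(θ).
  obtain ⟨Y, hY, hYmem⟩ := (hj.transfer₃ (fun V P L => ∀ x ∈ V, ∀ k ∈ V, ∀ l ∈ V, ∃ Y ∈ P,
    ∀ z ∈ V, (z ∈ Y ↔ ∃ a ∈ l, ∃ D ∈ V, ∃ p ∈ V, p = ZFSet.pair a k ∧ ZFSet.pair p D ∈ L ∧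
      ZFSet.pair x z ∈ D)) (V_ κ.ord) (V_ κ.ord).powerset L).1
    (fun x _ k _ l _ => ⟨(V_ κ.ord).sep fun z => ∃ a ∈ l, ∃ D ∈ V_ κ.ord, ∃ p ∈ V_ κ.ord,
      p = ZFSet.pair a k ∧ ZFSet.pair p D ∈ L ∧ ZFSet.pair x z ∈ D,
      ZFSet.mem_powerset.2 ZFSet.sep_subset, fun z hz => ZFSet.mem_sep.trans (and_iff_right hz)⟩)
    x (hV hx) _ (hV hk) _ (hV hl)
  have hYV : Y ⊆ j (V_ κ.ord) :=
    (hj.transfer₂ (fun P V => ∀ R ∈ P, R ⊆ V) (V_ κ.ord).powerset (V_ κ.ord)).1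
      (fun R h => ZFSet.mem_powerset.1 h) Y hY
  have hYeq : Y = (V_ θ).sep fun z => ZFSet.pair x z ∈ C := by
    ext z
    rw [ZFSet.mem_sep]
    constructor
    · intro hz
      obtain ⟨_, hal, D, hD, _, -, rfl, hDL, hxz⟩ := (hYmem z (hYV hz)).1 hz
      obtain ⟨a, ha, rfl⟩ := Ordinal.mem_toZFSet_iff.1 hal
      rw [hun _ (hV (hpθ a ha)) D hD _ (hV (hyθ a ha)) hDL (hyL a ha)] at hxz
      have hxzC := (ZFSet.mem_sep.1 hxz).1
      exact ⟨((pair_mem_vonNeumann hlim).1 (hC hxzC)).2, hxzC⟩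
    · rintro ⟨hz, hxz⟩
      obtain ⟨a, ha, h⟩ := hyC _ hxz
      exact (hYmem z (hV hz)).2 ⟨_, Ordinal.toZFSet_mem_toZFSet_iff.2 ha, _, hV (hyθ a ha), _,
        hV (hpθ a ha), rfl, hyL a ha, h⟩
  rw [← hYeq]
  exact hc.transitive _ (hj.apply_mem _) Y hY

/-- Every family of at most `|V_θ|` extenders has an upper bound in the Mitchell order. -/
theorem exists_upper_bound (hlim : Order.IsSuccLimit θ) (hcof : θ.cof ≤ κ)
    (hlt : κ.ord < θ) {ℓ : Ordinal.{u} → ZFSet.{u}}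
    (hℓ : IsJointLaverSequence κ θ θ.cof.ord ℓ) {ι : Type (u + 1)}
    (i : ι ↪ {x : ZFSet.{u} // x ∈ V_ θ}) (E : ι → {E : ZFSet.{u} // IsExtender κ θ E}) :
    ∃ F, ∀ k, MitchellOrder κ θ (E k) F := by
  -- Indexing by singletons keeps the section at ∅ free; it is filled with all of V_θ to meet the
  -- hypothesis on C.
  set C := (V_ θ).sep fun w => ∃ z, w = ZFSet.pair ∅ z ∨
    ∃ k, w = ZFSet.pair {(i k : ZFSet.{u})} z ∧ z ∈ (E k).1 with hC
  have hsing : ∀ k, ({(i k : ZFSet.{u})} : ZFSet.{u}) ∈ V_ θ := fun k => by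
    rw [ZFSet.mem_vonNeumann, ZFSet.rank_singleton]
    exact hlim.succ_lt (ZFSet.mem_vonNeumann.1 (i k).2)
  obtain ⟨F, N, π, hc, hF⟩ := exists_extender_of_joint hlim hcof hlt hℓ (C := C)
    ZFSet.sep_subset fun z hz => ZFSet.mem_sep.2
      ⟨(pair_mem_vonNeumann hlim).2 ⟨empty_mem_vonNeumann hlim, hz⟩, z, Or.inl rfl⟩
  refine ⟨F, fun k => ⟨N, π, hc, ?_⟩⟩
  have hEk : (E k).1 ⊆ V_ θ := by
    obtain ⟨e, -, h⟩ := (E k).2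
    rw [h]
    exact derivedExtender_subset hlim hlt e
  convert hF _ (hsing k)
  ext z
  rw [ZFSet.mem_sep, hC, ZFSet.mem_sep]
  constructor
  · intro hz
    exact ⟨hEk hz, (pair_mem_vonNeumann hlim).2 ⟨hsing k, hEk hz⟩, z, Or.inr ⟨k, rfl, hz⟩⟩
  · rintro ⟨-, -, z', h | ⟨k', h, hz⟩⟩
    · exact absurd (ZFSet.pair_inj.1 h).1 fun h0 => by
        have := ZFSet.mem_singleton.2 (rfl : (i k : ZFSet.{u}) = i k)
        rw [h0] at this
        exact ZFSet.notMem_empty _ this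
    · obtain ⟨h1, rfl⟩ := ZFSet.pair_inj.1 h
      rw [ZFSet.singleton_inj] at h1
      rwa [i.injective (Subtype.ext h1)]

/-- By induction on ξ: there are at most ℶ_θ = |V_θ| ordinals η < ξ, so the extenders chosen for
them have a common upper bound, whose rank exceeds every such η. -/
theorem exists_le_rank (hlim : Order.IsSuccLimit θ) (hcof : θ.cof ≤ κ)
    (hlt : κ.ord < θ) (hcard : (V_ θ).card = Cardinal.beth θ) {ℓ : Ordinal.{u} → ZFSet.{u}}
    (hℓ : IsJointLaverSequence κ θ θ.cof.ord ℓ) [IsWellFounded _ (MitchellOrder κ θ)]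
    (ξ : Ordinal.{u}) (hξ : ξ < (Order.succ (Cardinal.beth θ)).ord) :
    ∃ F, Ordinal.lift.{u + 1} ξ ≤ IsWellFounded.rank (MitchellOrder κ θ) F := by
  induction ξ using WellFoundedLT.induction with
  | ind ξ ih =>
    choose E hE using fun η : Set.Iio ξ => ih η η.2 (η.2.trans hξ)
    have hle : Cardinal.mk (Set.Iio ξ) ≤ Cardinal.mk {x : ZFSet.{u} // x ∈ V_ θ} := by
      have h1 : Cardinal.mk {x : ZFSet.{u} // x ∈ V_ θ} = Cardinal.lift.{u + 1} (V_ θ).card :=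
        ZFSet.cardinalMk_coe_sort
      rw [h1, Cardinal.mk_Iio_ordinal, hcard, Cardinal.lift_le, ← Order.lt_succ_iff]
      exact Cardinal.lt_ord.1 hξ
    obtain ⟨i⟩ := Cardinal.le_def _ _ |>.1 hle
    obtain ⟨F, hF⟩ := exists_upper_bound hlim hcof hlt hℓ i E
    refine ⟨F, le_of_forall_lt fun o ho => ?_⟩
    obtain ⟨η, hη, rfl⟩ := Ordinal.lt_lift_iff.1 ho
    exact (hE ⟨η, hη⟩).trans_lt (IsWellFounded.rank_lt_of_rel (hF ⟨η, hη⟩))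

end StrongLaver

theorem mainTheorem5 (κ : Cardinal.{u}) (θ : Ordinal.{u}) (hstrong : StrongLaver.IsStrong κ θ)
    (hlim : Order.IsSuccLimit θ) (hcof : θ.cof ≤ κ) (hlt : κ.ord < θ)
    (hjoint : ∃ ℓ : Ordinal.{u} → ZFSet.{u},
      StrongLaver.IsJointLaverSequence κ θ θ.cof.ord ℓ) :
    StrongLaver.HasMitchellRank κ θ (Order.succ (Cardinal.beth θ)).ord := by
  obtain ⟨e⟩ := hstrong
  obtain ⟨ℓ, hℓ⟩ := hjoint
  have hwf : IsWellFounded _ (StrongLaver.MitchellOrder κ θ) :=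
    ⟨StrongLaver.wellFounded_mitchellOrder hlim hlt⟩
  refine ⟨hwf, le_antisymm (Ordinal.iSup_le fun E => Order.succ_le_of_lt
    (StrongLaver.rank_mitchellOrder_lt hlim hlt E)) (le_of_forall_lt fun o ho => ?_)⟩
  obtain ⟨ξ, hξ, rfl⟩ := Ordinal.lt_lift_iff.1 ho
  obtain ⟨F, hF⟩ := StrongLaver.exists_le_rank hlim hcof hlt (e.card_vonNeumann_eq_beth hlt.le)
    hℓ ξ hξ
  exact (Order.lt_succ_of_le hF).trans_le (Ordinal.le_iSup (fun E => Order.succ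
    (IsWellFounded.rank (StrongLaver.MitchellOrder κ θ) E)) F)
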